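/- Setting. Let $d\ge 1$, $T\in\mathbb N$ and $\delta\in(0,1)$. Let $D$ be a probability distribution over contexts; each context is identified with its action set $\mathcal A\subset\{a\in\mathbb R^d:\|a\|_2\le 1\}$. Let $\mathcal A_1,\dots,\mathcal A_T$ be i.i.d. from $D$. For an action set $\mathcal A$ let $\Delta(\mathcal A)$ be the set of probability measures on $\mathcal A$, for an action $a$ write $\boldsymbol a=(a,1)\in\mathbb R^{d+1}$, and for $\nu\in\Delta(\mathcal A)$ let $\widehat{\mathrm{Cov}}(\nu)=\mathbb E_{a\sim\nu}[\boldsymbol a\boldsymbol a^\top]$; put $\mathcal H^{\mathcal A}=\{\widehat{\mathrm{Cov}}(\nu):\nu\in\Delta(\mathcal A)\}$. A policy $p$ maps every context $\mathcal A$ measurably to some $p^{\mathcal A}\in\Delta(\mathcal A)$. With $F(\boldsymbol H)=-\log\det\boldsymbol H$ (equal to $+\infty$ where $\det \boldsymbol H=0$), the class of policies the algorithm (follow-the-regularized-leader with the log-determinant barrier) can generate is the set $\mathbf P$ of all policies $p$ for which there is a symmetric $\boldsymbol Z\in[-T^2,T^2]^{(d+1)\times(d+1)}$ such that, for every context $\mathcal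 A$, $\widehat{\mathrm{Cov}}(p^{\mathcal A})$ minimizes $\langle \boldsymbol H,\boldsymbol Z\rangle+F(\boldsymbol H)$ over $\boldsymbol H\in\mathcal H^{\mathcal A}$, with a finite minimum. For $2\le t\le T$ and a policy $p$ define $$x(p)=\mathbb E_{\mathcal A\sim D}\mathbb E_{a\sim p^{\mathcal A}}[a],\qquad \hat x_t(p)=\frac1{t-1}\sum_{\tau=1}^{t-1}\mathbb E_{a\sim p^{\mathcal A_\tau}}[a],$$ $$H_t(p)=\mathbb E_{\mathcal A\sim D}\mathbb E_{a\sim p^{\mathcal A}}\big[(a-\hat x_t(p))(a-\hat x_t(p))^\top\big],\qquad \hat H_t(p)=\frac1{t-1}\sum_{\tau=1}^{t-1}\mathbb E_{a\sim p^{\mathcal A_\tau}}\big[(a-\hat x_t(p))(a-\hat x_t(p))^\top\big],$$ $$\boldsymbol H(p)=\mathbb E_{\mathcal A\sim D}\mathbb E_{a\sim p^{\mathcal A}}[\boldsymbol a\boldsymbol a^\top],\qquad \hat{\boldsymbol H}_t(p)=\frac1{t-1}\sum_{\tau=1}^{t-1}\mathbb E_{a\sim p^{\mathcal A_\tau}}[\boldsymbol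 a\boldsymbol a^\top],\qquad \hat\Sigma_t(p)=\hat H_t(p)+\beta_t I,$$ where the $\beta_t$ are real numbers with $\beta_t=\Theta\big((d+1)^3\log(T/\delta)/(t-1)\big)$, that is, $c_1\frac{(d+1)^3\log(T/\delta)}{t-1}\le\beta_t\le c_2\frac{(d+1)^3\log(T/\delta)}{t-1}$ for constants $0<c_1\le c_2$. Write $\|v\|_M^2=v^\top Mv$, and $A\succeq B$ if $A-B$ is positive semidefinite. Claim. For all $0<c_1\le c_2$ there is a constant $C>0$, depending only on $c_1,c_2$, such that in the above setting, with probability at least $1-\delta$, the following holds simultaneously for all $2\le t\le T$, all policies $p\in\mathbf P$ and all $y\in\mathbb R^d$ with $\|y\|_2\le1$: 1. $\displaystyle \big\|(\hat\Sigma_t(p)-H_t(p))\,y\big\|^2_{\hat\Sigma_t(p)^{-1}}\le C\,\frac{d^3\log(dT/\delta)}{t}$; 2. $\displaystyle \big\|x(p)-\hat x_t(p)\big\|^2_{\hat\Sigma_t(p)^{-1}}\le C\,\frac{d^3\log(dT/\delta)}{t}$; 3. $\displaystyle \hat H_t(p)+\frac{50(d+1)^3\log(3T/\delta)}{t-1}\,I\succeq\tfrac12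 H_t(p)$ and $\displaystyle \hat{\boldsymbol H}_t(p)+\frac{50(d+1)^3\log(3T/\delta)}{t-1}\,\boldsymbol I\succeq\tfrac12\boldsymbol H(p)$. -/

import Mathlib

open MeasureTheory ProbabilityTheory Matrix

noncomputable section

namespace LinCB

/-- Actions live in `ℝ^d` with the Euclidean norm. -/
abbrev Action (d : ℕ) : Type := EuclideanSpace ℝ (Fin d)

/-- The lifted action `(a, 1) ∈ ℝ^{d+1}`, with coordinates indexed by `Fin d ⊕ Unit`. -/
def lift {d : ℕ} (a : Action d) : Fin d ⊕ Unit → ℝ := Sum.elim (fun i => a i) (fun _ => 1)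

/-- The mean `μ(ν) = E_{a ∼ ν}[a]`. -/
def mean {d : ℕ} (ν : Measure (Action d)) : Fin d → ℝ := fun i => ∫ a, a i ∂ν

/-- The second moment `E_{a ∼ ν}[(a - v)(a - v)ᵀ]` around a vector `v`. -/
def secondMoment {d : ℕ} (ν : Measure (Action d)) (v : Fin d → ℝ) : Matrix (Fin d) (Fin d) ℝ :=
  Matrix.of fun i j => ∫ a, (a i - v i) * (a j - v j) ∂ν

/-- The lifted covariance matrix `E_{a ∼ ν}[(a, 1)(a, 1)ᵀ]`. -/
def liftedCov {d : ℕ} (ν : Measure (Action d)) : Matrix (Fin d ⊕ Unit) (Fin d ⊕ Unit) ℝ :=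
  Matrix.of fun i j => ∫ a, lift a i * lift a j ∂ν

/-- `ν ∈ Δ(A)`: `ν` is a probability measure carried by the action set `A`. -/
def IsDistOn {d : ℕ} (A : Set (Action d)) (ν : Measure (Action d)) : Prop :=
  IsProbabilityMeasure ν ∧ ∀ᵐ a ∂ν, a ∈ A

/-- The set `{liftedCov ν : ν ∈ Δ(A)}` of lifted covariance matrices available on `A`. -/
def liftedSet {d : ℕ} (A : Set (Action d)) : Set (Matrix (Fin d ⊕ Unit) (Fin d ⊕ Unit) ℝ) :=
  {H | ∃ ν, IsDistOn A ν ∧ H = liftedCov ν}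

/-- The objective `⟨H, Z⟩ + F(H)` with the log-determinant barrier `F(H) = - log det H`.
The barrier is `+∞` where `det H = 0`; see `IsArgmin`. -/
def objective {d : ℕ} (Z H : Matrix (Fin d ⊕ Unit) (Fin d ⊕ Unit) ℝ) : ℝ :=
  (Hᵀ * Z).trace - Real.log H.det

/-- `H` minimizes `⟨H, Z⟩ + F(H)` over the lifted covariance matrices available on `A`, with a
finite value: elements of `liftedSet A` with zero determinant have infinite objective. -/
def IsArgmin {d : ℕ} (A : Set (Action d)) (Z H : Matrix (Fin d ⊕ Unit) (Fin d ⊕ Unit) ℝ) : Prop :=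
  H ∈ liftedSet A ∧ 0 < H.det ∧
    ∀ H' ∈ liftedSet A, 0 < H'.det → objective Z H ≤ objective Z H'

/-- The symmetric matrices of size `d + 1` with entries in `[-T², T²]`. -/
def parameterBox (d T : ℕ) : Set (Matrix (Fin d ⊕ Unit) (Fin d ⊕ Unit) ℝ) :=
  {Z | Z.IsSymm ∧ ∀ i j, |Z i j| ≤ (T : ℝ) ^ 2}

/-- The policies that the algorithm can generate. A context `x : X` carries the action set
`act x`; a policy assigns to each context, measurably, a distribution on its action set. -/
def policyClass {X : Type*} [MeasurableSpace X] {d : ℕ} (act : X → Set (Action d)) (T : ℕ) :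
    Set (Kernel X (Action d)) :=
  {p | (∀ x, IsDistOn (act x) (p x)) ∧
    ∃ Z ∈ parameterBox d T, ∀ x, IsArgmin (act x) Z (liftedCov (p x))}

section Quantities

variable {X : Type*} [MeasurableSpace X] {d : ℕ}

/-- `x(p) = E_{A ∼ D} E_{a ∼ p^A}[a]`. -/
def popMean (D : Measure X) (p : Kernel X (Action d)) : Fin d → ℝ :=
  fun i => ∫ x, mean (p x) i ∂D

/-- `x̂_t(p)`: the average of `E_{a ∼ p^A}[a]` over the contexts `A = c 1, …, c (t - 1)`. -/
def empMean (c : ℕ → X) (t : ℕ) (p : Kernel X (Action d)) : Fin d → ℝ :=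
  ((t : ℝ) - 1)⁻¹ • ∑ τ ∈ Finset.Ico 1 t, mean (p (c τ))

/-- `H_t(p) = E_{A ∼ D} E_{a ∼ p^A}[(a - x̂_t(p))(a - x̂_t(p))ᵀ]`, which is centered at the
empirical mean. -/
def popCov (D : Measure X) (c : ℕ → X) (t : ℕ) (p : Kernel X (Action d)) :
    Matrix (Fin d) (Fin d) ℝ :=
  Matrix.of fun i j => ∫ x, secondMoment (p x) (empMean c t p) i j ∂D

/-- `Ĥ_t(p)`: the average of `E_{a ∼ p^A}[(a - x̂_t(p))(a - x̂_t(p))ᵀ]` over the contexts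
`A = c 1, …, c (t - 1)`. -/
def empCov (c : ℕ → X) (t : ℕ) (p : Kernel X (Action d)) : Matrix (Fin d) (Fin d) ℝ :=
  ((t : ℝ) - 1)⁻¹ • ∑ τ ∈ Finset.Ico 1 t, secondMoment (p (c τ)) (empMean c t p)

/-- The lifted population matrix `E_{A ∼ D} E_{a ∼ p^A}[(a, 1)(a, 1)ᵀ]`. -/
def popLifted (D : Measure X) (p : Kernel X (Action d)) :
    Matrix (Fin d ⊕ Unit) (Fin d ⊕ Unit) ℝ :=
  Matrix.of fun i j => ∫ x, liftedCov (p x) i j ∂D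

/-- The average of `E_{a ∼ p^A}[(a, 1)(a, 1)ᵀ]` over the contexts `A = c 1, …, c (t - 1)`. -/
def empLifted (c : ℕ → X) (t : ℕ) (p : Kernel X (Action d)) :
    Matrix (Fin d ⊕ Unit) (Fin d ⊕ Unit) ℝ :=
  ((t : ℝ) - 1)⁻¹ • ∑ τ ∈ Finset.Ico 1 t, liftedCov (p (c τ))

/-- `Σ̂_t(p) = Ĥ_t(p) + β I`. -/
def sigmaHat (β : ℝ) (c : ℕ → X) (t : ℕ) (p : Kernel X (Action d)) : Matrix (Fin d) (Fin d) ℝ :=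
  empCov c t p + β • (1 : Matrix (Fin d) (Fin d) ℝ)

end Quantities

/-- The squared norm `‖v‖²_M = vᵀ M v` generated by a positive semidefinite matrix `M`. -/
def sqNorm {d : ℕ} (M : Matrix (Fin d) (Fin d) ℝ) (v : Fin d → ℝ) : ℝ := v ⬝ᵥ (M *ᵥ v)

end LinCB

end

/-! All quantities in the claim depend on a policy only through its lifted covariances, and these
are controlled, for every context at once, by the single matrix `Z`. On matrices bounded by `2 I`
the Hessian of `-log det` is at least `1/4` in Frobenius norm, so the minimizer is a Lipschitz
function of `Z` with a constant independent of the context (`IsArgmin.sum_sq_sub_le`). The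
infinite-dimensional policy class thus has finite metric entropy: with `k = d + 1`, a grid on `Z`
and on two unit directions `w`, `v` needs at most `(3T)^(4k³)` points.

At a grid point, Chernoff bounds control the forms `w·Gw` and `w·Gv`, where `G` is the lifted
covariance in a random context. By Cauchy–Schwarz `(w·Gv)² ≤ 2 w·Gw`, so the Bernstein deviation of
`w·Gv` is governed by the mean of `w·Gw`; a multiplicative lower tail bounds that mean by its
empirical counterpart. Each point fails with probability at most `3 exp(-5ℓ)`, where `ℓ = k³
log(3T/δ)`, which leaves room for a union over the grid and the rounds (`exists_uniform_event`).

Centering at the data-dependent mean is the linear map `(a, 1) ↦ a - x̂`, applied on both sides of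
the lifted matrices. Since the bounds hold for all directions, a random linear map is harmless.
Duality, `‖u‖²_{M⁻¹} ≤ B` when `(z·u)² ≤ B z·Mz` for all `z`, then turns directional bounds into
local-norm bounds (`bounds_of_lifted`). -/

namespace LinCB

/-! ### Strong convexity of the log-determinant barrier and stability of its minimizers. -/

section LinearAlgebra

variable {n : Type*} [Fintype n]

lemma dotProduct_mulVec_self_nonneg {A : Matrix n n ℝ} (hA : A.PosSemidef) (x : n → ℝ) :
    0 ≤ x ⬝ᵥ (A *ᵥ x) := by
  simpa using hA.dotProduct_mulVec_nonneg x

open scoped MatrixOrder in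
lemma exists_eq_conjTranspose_mul_self {A : Matrix n n ℝ} (hA : A.PosSemidef) :
    ∃ C : Matrix n n ℝ, A = Cᴴ * C := by
  classical
  exact CStarAlgebra.nonneg_iff_eq_star_mul_self.mp hA.nonneg

lemma trace_mul_nonneg {A B : Matrix n n ℝ} (hA : A.PosSemidef) (hB : B.PosSemidef) :
    0 ≤ (A * B).trace := by
  obtain ⟨C, rfl⟩ := exists_eq_conjTranspose_mul_self hA
  rw [Matrix.mul_assoc, Matrix.trace_mul_comm]
  exact (hB.mul_mul_conjTranspose_same C).trace_nonneg

lemma posSemidef_conj_of_symm {B Δ : Matrix n n ℝ} (hB : B.PosSemidef) (hΔ : Δᵀ = Δ) :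
    (Δ * B * Δ).PosSemidef := by
  have := hB.mul_mul_conjTranspose_same Δ
  rwa [Matrix.conjTranspose_eq_transpose_of_trivial, hΔ] at this

lemma trace_transpose_mul_eq (A B : Matrix n n ℝ) :
    (Aᵀ * B).trace = ∑ i, ∑ j, A i j * B i j := by
  simp only [Matrix.trace, Matrix.diag, Matrix.mul_apply, Matrix.transpose_apply]
  exact Finset.sum_comm

variable [DecidableEq n]

/-- Sum `log λ ≤ λ - 1` over the eigenvalues. -/
lemma log_det_le_trace_sub_card {A : Matrix n n ℝ} (hA : A.PosDef) :
    Real.log A.det ≤ A.trace - Fintype.card n := by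
  have hdet := hA.1.det_eq_prod_eigenvalues
  have htr := hA.1.trace_eq_sum_eigenvalues
  simp only [RCLike.ofReal_real_eq_id, id_eq] at hdet htr
  rw [hdet, htr, Real.log_prod (fun i _ => (hA.eigenvalues_pos i).ne')]
  calc ∑ i, Real.log (hA.1.eigenvalues i) ≤ ∑ i, (hA.1.eigenvalues i - 1) :=
        Finset.sum_le_sum fun i _ => Real.log_le_sub_one_of_pos (hA.eigenvalues_pos i)
    _ = _ := by simp

/-- The tangent inequality of the concave function `log det`. -/
lemma log_det_le_tangent {A B : Matrix n n ℝ} (hA : A.PosDef) (hB : B.PosDef) :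
    Real.log B.det ≤ Real.log A.det + (A⁻¹ * (B - A)).trace := by
  -- With `A⁻¹ = Cᴴ C`, the congruence by `C` sends `A` to the identity, which reduces the claim to
  -- the tangent inequality there.
  obtain ⟨C, hC⟩ := exists_eq_conjTranspose_mul_self hA.inv.posSemidef
  have hAu : IsUnit A.det := (Matrix.isUnit_iff_isUnit_det _).mp hA.isUnit
  have hCdet : C.det * C.det = (A.det)⁻¹ := by
    have := congrArg Matrix.det hC
    rw [Matrix.det_mul, Matrix.det_conjTranspose, Matrix.det_nonsing_inv,
      Ring.inverse_eq_inv'] at this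
    simpa using this.symm
  have hpd : (C * B * Cᴴ).PosDef := by
    have h := hB.posSemidef.mul_mul_conjTranspose_same C
    refine h.posDef_iff_det_ne_zero.mpr ?_
    have h0 : C.det ≠ 0 := by
      intro h0
      rw [h0, zero_mul] at hCdet
      exact inv_ne_zero hA.det_pos.ne' hCdet.symm
    simp [Matrix.det_mul, h0, hB.det_pos.ne']
  have h := log_det_le_trace_sub_card hpd
  have e1 : (C * B * Cᴴ).det = B.det * (A.det)⁻¹ := by
    rw [← hCdet]; simp [Matrix.det_mul]; ring
  have e2 : (C * B * Cᴴ).trace = (A⁻¹ * B).trace := by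
    rw [Matrix.trace_mul_comm, ← Matrix.mul_assoc, hC]
  rw [e1, e2, Real.log_mul hB.det_pos.ne' (inv_ne_zero hA.det_pos.ne'), Real.log_inv] at h
  rw [Matrix.mul_sub, Matrix.trace_sub, Matrix.nonsing_inv_mul _ hAu, Matrix.trace_one]
  linarith

lemma posSemidef_inv_sub_half {A : Matrix n n ℝ} (hA : A.PosDef)
    (h2 : ∀ w : n → ℝ, w ⬝ᵥ (A *ᵥ w) ≤ 2 * (w ⬝ᵥ w)) :
    (A⁻¹ - (1 / 2 : ℝ) • (1 : Matrix n n ℝ)).PosSemidef := by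
  have hAu : IsUnit A.det := (Matrix.isUnit_iff_isUnit_det _).mp hA.isUnit
  refine Matrix.PosSemidef.of_dotProduct_mulVec_nonneg
    (hA.inv.1.sub (by simp [Matrix.IsHermitian])) fun y => ?_
  -- Expanding this square in the `A`-form gives `y·A⁻¹y ≥ y·y - (1/4) y·Ay`.
  have h := dotProduct_mulVec_self_nonneg hA.posSemidef (A⁻¹ *ᵥ y - (1 / 2 : ℝ) • y)
  have h3 := h2 y
  have hsym : ∀ u v : n → ℝ, u ⬝ᵥ (A *ᵥ v) = (A *ᵥ u) ⬝ᵥ v := by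
    intro u v
    rw [Matrix.dotProduct_mulVec, ← Matrix.mulVec_transpose]
    have : Aᵀ = A := by simpa [Matrix.IsHermitian] using hA.1
    rw [this]
  have hi : A *ᵥ (A⁻¹ *ᵥ y) = y := by
    rw [Matrix.mulVec_mulVec, Matrix.mul_nonsing_inv _ hAu, Matrix.one_mulVec]
  rw [Matrix.mulVec_sub, Matrix.mulVec_smul, hi, sub_dotProduct, dotProduct_sub,
    dotProduct_sub, dotProduct_smul, dotProduct_smul, hsym (A⁻¹ *ᵥ y), hi,
    dotProduct_comm (A⁻¹ *ᵥ y)] at h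
  simp only [star_trivial, Matrix.sub_mulVec, Matrix.smul_mulVec, Matrix.one_mulVec,
    dotProduct_sub, dotProduct_smul, smul_dotProduct, smul_eq_mul] at h ⊢
  linarith

/-- A lower bound for a Hessian of `-log det` polarized at two points: each of the factors `A`, `B`
is replaced by `1/2` in turn. -/
lemma quarter_trace_sq_le {A B Δ : Matrix n n ℝ} (hΔ : Δᵀ = Δ)
    (hA : (A - (1 / 2 : ℝ) • (1 : Matrix n n ℝ)).PosSemidef)
    (hB : (B - (1 / 2 : ℝ) • (1 : Matrix n n ℝ)).PosSemidef) :
    (Δ * Δ).trace / 4 ≤ (A * Δ * B * Δ).trace := by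
  have hB' : B.PosSemidef := by
    have := hB.add ((Matrix.PosSemidef.one (n := n) (R := ℝ)).smul (by norm_num : (0:ℝ) ≤ 1 / 2))
    simpa using this
  have h1 := trace_mul_nonneg hA (posSemidef_conj_of_symm hB' hΔ)
  have h2 := (posSemidef_conj_of_symm hB hΔ).trace_nonneg
  simp only [Matrix.sub_mul, Matrix.mul_sub, Matrix.smul_mul, Matrix.mul_smul, Matrix.one_mul,
    Matrix.mul_one, Matrix.trace_sub, Matrix.trace_smul, smul_eq_mul] at h1 h2
  rw [← Matrix.mul_assoc, ← Matrix.mul_assoc] at h1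
  linarith

/-- Minimizers of `⟨H, Z⟩ - log det H` over a convex set of matrices bounded by `2 I` depend on `Z`
in a Lipschitz way; it is enough to compare with two points of the segment between them. -/
lemma sum_sq_sub_le_of_isMin {H H' Z Z' : Matrix n n ℝ} (hH : H.PosDef) (hH' : H'.PosDef)
    (h2 : ∀ w : n → ℝ, w ⬝ᵥ (H *ᵥ w) ≤ 2 * (w ⬝ᵥ w))
    (h2' : ∀ w : n → ℝ, w ⬝ᵥ (H' *ᵥ w) ≤ 2 * (w ⬝ᵥ w))
    (hmin : (Hᵀ * Z).trace - Real.log H.det ≤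
      (((3 / 4 : ℝ) • H + (1 / 4 : ℝ) • H')ᵀ * Z).trace
        - Real.log ((3 / 4 : ℝ) • H + (1 / 4 : ℝ) • H').det)
    (hmin' : (H'ᵀ * Z').trace - Real.log H'.det ≤
      (((3 / 4 : ℝ) • H' + (1 / 4 : ℝ) • H)ᵀ * Z').trace
        - Real.log ((3 / 4 : ℝ) • H' + (1 / 4 : ℝ) • H).det) :
    ∑ i, ∑ j, (H i j - H' i j) ^ 2 ≤ 64 * ∑ i, ∑ j, (Z i j - Z' i j) ^ 2 := by
  set M := (3 / 4 : ℝ) • H + (1 / 4 : ℝ) • H' with hM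
  set M' := (3 / 4 : ℝ) • H' + (1 / 4 : ℝ) • H with hM'
  set Δ := H' - H with hΔ
  have hMpd : M.PosDef := (hH.smul (by norm_num : (0:ℝ) < 3 / 4)).add
    (hH'.smul (by norm_num : (0:ℝ) < 1 / 4))
  have hMpd' : M'.PosDef := (hH'.smul (by norm_num : (0:ℝ) < 3 / 4)).add
    (hH.smul (by norm_num : (0:ℝ) < 1 / 4))
  have b : ∀ w : n → ℝ, w ⬝ᵥ (M *ᵥ w) ≤ 2 * (w ⬝ᵥ w) := fun w => by
    have := h2 w; have := h2' w
    simp only [hM, Matrix.add_mulVec, Matrix.smul_mulVec, dotProduct_add, dotProduct_smul,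
      smul_eq_mul]
    linarith
  have b' : ∀ w : n → ℝ, w ⬝ᵥ (M' *ᵥ w) ≤ 2 * (w ⬝ᵥ w) := fun w => by
    have := h2 w; have := h2' w
    simp only [hM', Matrix.add_mulVec, Matrix.smul_mulVec, dotProduct_add, dotProduct_smul,
      smul_eq_mul]
    linarith
  have hΔs : Δᵀ = Δ := by
    have e : Hᵀ = H := by simpa [Matrix.IsHermitian] using hH.1
    have e' : H'ᵀ = H' := by simpa [Matrix.IsHermitian] using hH'.1
    rw [hΔ, Matrix.transpose_sub, e, e']
  have t := log_det_le_tangent hMpd hH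
  have t' := log_det_le_tangent hMpd' hH'
  have s1 : H - M = -((1 / 4 : ℝ) • Δ) := by rw [hM, hΔ]; module
  have s1' : H' - M' = (1 / 4 : ℝ) • Δ := by rw [hM', hΔ]; module
  have s2 : M = H + (1 / 4 : ℝ) • Δ := by rw [hM, hΔ]; module
  have s2' : M' = H' - (1 / 4 : ℝ) • Δ := by rw [hM', hΔ]; module
  have s3 : M' - M = (1 / 2 : ℝ) • Δ := by rw [hM, hM', hΔ]; module
  -- A substitute for the first-order optimality condition: the tangent at `M` bounds the
  -- log-determinant increment in the minimality inequality, so no derivative is needed.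
  have f : (M⁻¹ * Δ).trace ≤ (Δᵀ * Z).trace := by
    have e : (Mᵀ * Z).trace = (Hᵀ * Z).trace + (1 / 4) * (Δᵀ * Z).trace := by
      rw [s2]; simp [Matrix.add_mul]
    rw [e] at hmin
    rw [s1, Matrix.mul_neg, Matrix.trace_neg, Matrix.mul_smul, Matrix.trace_smul, smul_eq_mul] at t
    linarith
  have f' : (Δᵀ * Z').trace ≤ (M'⁻¹ * Δ).trace := by
    have e : (M'ᵀ * Z').trace = (H'ᵀ * Z').trace - (1 / 4) * (Δᵀ * Z').trace := by
      rw [s2']; simp [Matrix.sub_mul]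
    rw [e] at hmin'
    rw [s1', Matrix.mul_smul, Matrix.trace_smul, smul_eq_mul] at t'
    linarith
  have hu : IsUnit M.det := (Matrix.isUnit_iff_isUnit_det _).mp hMpd.isUnit
  have hu' : IsUnit M'.det := (Matrix.isUnit_iff_isUnit_det _).mp hMpd'.isUnit
  -- Resolvent identity; the factor `1/2` is the separation of the two quarter points `M` and `M'`
  -- along the segment.
  have g : M⁻¹ - M'⁻¹ = (1 / 2 : ℝ) • (M⁻¹ * Δ * M'⁻¹) := by
    have : M⁻¹ * (M' - M) * M'⁻¹ = M⁻¹ - M'⁻¹ := by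
      rw [Matrix.mul_sub, Matrix.sub_mul, Matrix.nonsing_inv_mul _ hu, Matrix.mul_assoc,
        Matrix.mul_nonsing_inv _ hu', Matrix.mul_one, Matrix.one_mul]
    rw [← this, s3]; simp
  have q := quarter_trace_sq_le hΔs (posSemidef_inv_sub_half hMpd b)
    (posSemidef_inv_sub_half hMpd' b')
  have k : (M⁻¹ * Δ).trace - (M'⁻¹ * Δ).trace = (1 / 2) * (M⁻¹ * Δ * M'⁻¹ * Δ).trace := by
    rw [← Matrix.trace_sub, ← Matrix.sub_mul, g, Matrix.smul_mul, Matrix.trace_smul, smul_eq_mul]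
  have hq : (Δ * Δ).trace = ∑ i, ∑ j, (H i j - H' i j) ^ 2 := by
    conv_lhs => rw [← hΔs]
    rw [hΔs, ← congrArg (· * Δ) hΔs, trace_transpose_mul_eq]
    refine Finset.sum_congr rfl fun i _ => Finset.sum_congr rfl fun j _ => ?_
    simp only [hΔ, Matrix.sub_apply]; ring
  have hz : (Δᵀ * Z).trace - (Δᵀ * Z').trace = ∑ i, ∑ j, Δ i j * (Z i j - Z' i j) := by
    rw [trace_transpose_mul_eq, trace_transpose_mul_eq, ← Finset.sum_sub_distrib]
    refine Finset.sum_congr rfl fun i _ => ?_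
    rw [← Finset.sum_sub_distrib]
    exact Finset.sum_congr rfl fun j _ => by ring
  have key : ∑ i, ∑ j, (H i j - H' i j) ^ 2 ≤ 8 * ∑ i, ∑ j, Δ i j * (Z i j - Z' i j) := by
    rw [← hq, ← hz]; linarith
  -- Young's inequality `8xy ≤ x²/2 + 32y²`; the first term is absorbed into the left side of `key`.
  have ptw : 8 * ∑ i, ∑ j, Δ i j * (Z i j - Z' i j) ≤
      ∑ i, ∑ j, ((H i j - H' i j) ^ 2 / 2 + 32 * (Z i j - Z' i j) ^ 2) := by
    simp only [Finset.mul_sum]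
    refine Finset.sum_le_sum fun i _ => Finset.sum_le_sum fun j _ => ?_
    simp only [hΔ, Matrix.sub_apply]
    nlinarith [sq_nonneg ((H' i j - H i j) - 8 * (Z i j - Z' i j))]
  simp only [Finset.sum_add_distrib, ← Finset.mul_sum, ← Finset.sum_div] at ptw
  linarith

end LinearAlgebra

/-! ### Lifted covariances: bounds, convexity, and Lipschitz dependence on the parameter. -/

section LiftedCov

variable {d : ℕ}

lemma dotProduct_self_nonneg {n : Type*} [Fintype n] (u : n → ℝ) : 0 ≤ u ⬝ᵥ u :=
  Finset.sum_nonneg fun i _ => mul_self_nonneg (u i)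

lemma dotProduct_sq_le {n : Type*} [Fintype n] (u v : n → ℝ) :
    (u ⬝ᵥ v) ^ 2 ≤ (u ⬝ᵥ u) * (v ⬝ᵥ v) := by
  simpa only [dotProduct, ← sq] using Finset.sum_mul_sq_le_sq_mul_sq Finset.univ u v

lemma lift_dotProduct_self (a : Action d) : lift a ⬝ᵥ lift a = ‖a‖ ^ 2 + 1 := by
  simp [dotProduct, lift, EuclideanSpace.norm_sq_eq, ← sq]

lemma lift_dotProduct_self_le {a : Action d} (ha : ‖a‖ ≤ 1) : lift a ⬝ᵥ lift a ≤ 2 := by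
  rw [lift_dotProduct_self]
  nlinarith [norm_nonneg a]

lemma dotProduct_lift_sq_le {a : Action d} (ha : ‖a‖ ≤ 1) (w : Fin d ⊕ Unit → ℝ) :
    (w ⬝ᵥ lift a) ^ 2 ≤ 2 * (w ⬝ᵥ w) := by
  have h0 : 0 ≤ w ⬝ᵥ w := dotProduct_self_nonneg w
  nlinarith [dotProduct_sq_le w (lift a), lift_dotProduct_self_le ha]

lemma abs_lift_le {a : Action d} (ha : ‖a‖ ≤ 1) (i : Fin d ⊕ Unit) : |lift a i| ≤ 1 := by
  rcases i with i | i
  · exact (PiLp.norm_apply_le a i).trans ha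
  · simp [lift]

lemma continuous_lift (i : Fin d ⊕ Unit) : Continuous fun a : Action d => lift a i := by
  rcases i with i | i
  · simp only [lift, Sum.elim_inl]; fun_prop
  · simp only [lift, Sum.elim_inr]; fun_prop

lemma integrable_lift_mul_lift {ν : Measure (Action d)} [IsFiniteMeasure ν]
    (hν : ∀ᵐ a ∂ν, ‖a‖ ≤ 1) (i j : Fin d ⊕ Unit) :
    Integrable (fun a => lift a i * lift a j) ν := by
  refine Integrable.of_bound
    ((continuous_lift i).mul (continuous_lift j)).aestronglyMeasurable 1 ?_
  filter_upwards [hν] with a ha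
  rw [norm_mul, Real.norm_eq_abs, Real.norm_eq_abs]
  exact mul_le_one₀ (abs_lift_le ha i) (abs_nonneg _) (abs_lift_le ha j)

lemma dotProduct_mul_dotProduct_eq_sum {n : Type*} [Fintype n] (w v u : n → ℝ) :
    (w ⬝ᵥ u) * (v ⬝ᵥ u) = ∑ i, ∑ j, w i * v j * (u i * u j) := by
  simp only [dotProduct, Finset.sum_mul_sum]
  exact Finset.sum_congr rfl fun i _ => Finset.sum_congr rfl fun j _ => by ring

lemma dotProduct_mulVec_eq_sum {m n : Type*} [Fintype m] [Fintype n] (M : Matrix m n ℝ)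
    (w : m → ℝ) (v : n → ℝ) : w ⬝ᵥ (M *ᵥ v) = ∑ i, ∑ j, w i * v j * M i j := by
  simp only [dotProduct, mulVec, Finset.mul_sum]
  exact Finset.sum_congr rfl fun i _ => Finset.sum_congr rfl fun j _ => by ring

lemma dotProduct_liftedCov_mulVec {ν : Measure (Action d)} [IsFiniteMeasure ν]
    (hν : ∀ᵐ a ∂ν, ‖a‖ ≤ 1) (w v : Fin d ⊕ Unit → ℝ) :
    w ⬝ᵥ (liftedCov ν *ᵥ v) = ∫ a, (w ⬝ᵥ lift a) * (v ⬝ᵥ lift a) ∂ν := by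
  simp only [dotProduct_mul_dotProduct_eq_sum]
  rw [integral_finsetSum _ fun i _ => integrable_finsetSum _ fun j _ =>
    (integrable_lift_mul_lift hν i j).const_mul _]
  rw [dotProduct_mulVec_eq_sum]
  refine Finset.sum_congr rfl fun i _ => ?_
  rw [integral_finsetSum _ fun j _ => (integrable_lift_mul_lift hν i j).const_mul _]
  exact Finset.sum_congr rfl fun j _ => by rw [integral_const_mul]; rfl

lemma liftedCov_transpose (ν : Measure (Action d)) : (liftedCov ν)ᵀ = liftedCov ν := by
  ext i j
  simp only [liftedCov, transpose_apply, of_apply, mul_comm]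

lemma posSemidef_liftedCov {ν : Measure (Action d)} [IsFiniteMeasure ν]
    (hν : ∀ᵐ a ∂ν, ‖a‖ ≤ 1) : (liftedCov ν).PosSemidef := by
  refine Matrix.PosSemidef.of_dotProduct_mulVec_nonneg (liftedCov_transpose ν) fun w => ?_
  rw [star_trivial, dotProduct_liftedCov_mulVec hν]
  exact integral_nonneg fun a => mul_self_nonneg _

lemma dotProduct_liftedCov_mulVec_self_le {ν : Measure (Action d)} [IsProbabilityMeasure ν]
    (hν : ∀ᵐ a ∂ν, ‖a‖ ≤ 1) (w : Fin d ⊕ Unit → ℝ) :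
    w ⬝ᵥ (liftedCov ν *ᵥ w) ≤ 2 * (w ⬝ᵥ w) := by
  rw [dotProduct_liftedCov_mulVec hν]
  calc ∫ a, (w ⬝ᵥ lift a) * (w ⬝ᵥ lift a) ∂ν ≤ ∫ _, 2 * (w ⬝ᵥ w) ∂ν := by
        refine integral_mono_of_nonneg (.of_forall fun a => mul_self_nonneg _)
          (integrable_const _) ?_
        filter_upwards [hν] with a ha
        rw [← sq]
        exact dotProduct_lift_sq_le ha w
    _ = _ := by simp

lemma IsDistOn.ae_norm_le_one {A : Set (Action d)} (hA : ∀ a ∈ A, ‖a‖ ≤ 1)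
    {ν : Measure (Action d)} (hν : IsDistOn A ν) : ∀ᵐ a ∂ν, ‖a‖ ≤ 1 :=
  hν.2.mono fun a ha => hA a ha

/-- `liftedCov` is affine in the measure, and mixtures of distributions on `A` remain distributions
on `A`. -/
lemma convex_liftedSet {A : Set (Action d)} (hA : ∀ a ∈ A, ‖a‖ ≤ 1) : Convex ℝ (liftedSet A) := by
  rintro _ ⟨ν, hν, rfl⟩ _ ⟨ν', hν', rfl⟩ s s' hs hs' hss
  have := hν.1
  have := hν'.1
  have hi := integrable_lift_mul_lift (hν.ae_norm_le_one hA)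
  have hi' := integrable_lift_mul_lift (hν'.ae_norm_le_one hA)
  refine ⟨ENNReal.ofReal s • ν + ENNReal.ofReal s' • ν', ⟨⟨?_⟩, ?_⟩, ?_⟩
  · simp [← ENNReal.ofReal_add hs hs', hss]
  · rw [ae_add_measure_iff]
    exact ⟨Measure.ae_smul_measure hν.2 _, Measure.ae_smul_measure hν'.2 _⟩
  · ext i j
    simp only [liftedCov, Matrix.add_apply, Matrix.smul_apply, of_apply, smul_eq_mul]
    rw [integral_add_measure ((hi i j).smul_measure ENNReal.ofReal_ne_top)
      ((hi' i j).smul_measure ENNReal.ofReal_ne_top), integral_smul_measure,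
      integral_smul_measure, ENNReal.toReal_ofReal hs, ENNReal.toReal_ofReal hs', smul_eq_mul,
      smul_eq_mul]

lemma IsArgmin.posDef {A : Set (Action d)} (hA : ∀ a ∈ A, ‖a‖ ≤ 1)
    {Z H : Matrix (Fin d ⊕ Unit) (Fin d ⊕ Unit) ℝ} (h : IsArgmin A Z H) : H.PosDef := by
  obtain ⟨⟨ν, hν, rfl⟩, hdet, -⟩ := h
  have := hν.1
  exact (posSemidef_liftedCov (hν.ae_norm_le_one hA)).posDef_iff_det_ne_zero.mpr hdet.ne'

lemma IsArgmin.le_two {A : Set (Action d)} (hA : ∀ a ∈ A, ‖a‖ ≤ 1)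
    {Z H : Matrix (Fin d ⊕ Unit) (Fin d ⊕ Unit) ℝ} (h : IsArgmin A Z H)
    (w : Fin d ⊕ Unit → ℝ) : w ⬝ᵥ (H *ᵥ w) ≤ 2 * (w ⬝ᵥ w) := by
  obtain ⟨⟨ν, hν, rfl⟩, -, -⟩ := h
  have := hν.1
  exact dotProduct_liftedCov_mulVec_self_le (hν.ae_norm_le_one hA) w

/-- The minimizer of the regularized objective is a Lipschitz function of the parameter. -/
lemma IsArgmin.sum_sq_sub_le {A : Set (Action d)} (hA : ∀ a ∈ A, ‖a‖ ≤ 1)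
    {Z Z' H H' : Matrix (Fin d ⊕ Unit) (Fin d ⊕ Unit) ℝ} (h : IsArgmin A Z H)
    (h' : IsArgmin A Z' H') :
    ∑ i, ∑ j, (H i j - H' i j) ^ 2 ≤ 64 * ∑ i, ∑ j, (Z i j - Z' i j) ^ 2 := by
  have hc := convex_liftedSet hA
  have pd := h.posDef hA
  have pd' := h'.posDef hA
  refine sum_sq_sub_le_of_isMin pd pd' (h.le_two hA) (h'.le_two hA)
    (h.2.2 _ (hc h.1 h'.1 (by norm_num) (by norm_num) (by norm_num)) ?_)
    (h'.2.2 _ (hc h'.1 h.1 (by norm_num) (by norm_num) (by norm_num)) ?_)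
  · exact ((pd.smul (by norm_num : (0:ℝ) < 3 / 4)).add
      (pd'.smul (by norm_num : (0:ℝ) < 1 / 4))).det_pos
  · exact ((pd'.smul (by norm_num : (0:ℝ) < 3 / 4)).add
      (pd.smul (by norm_num : (0:ℝ) < 1 / 4))).det_pos

lemma measurable_liftedCov {X : Type*} [MeasurableSpace X] (p : Kernel X (Action d))
    [IsMarkovKernel p] (i j : Fin d ⊕ Unit) : Measurable fun x => liftedCov (p x) i j :=
  (StronglyMeasurable.integral_kernel
    ((continuous_lift i).mul (continuous_lift j)).stronglyMeasurable).measurable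

end LiftedCov

/-! ### Chernoff and Bernstein bounds for i.i.d. contexts. -/

section Concentration

variable {X Ω : Type*} [MeasurableSpace X] [MeasurableSpace Ω] {D : Measure X}
  {μ : Measure Ω} [IsProbabilityMeasure μ] {ctx : ℕ → Ω → X} {T t : ℕ}

/-- The Chernoff bound for a sum over i.i.d. contexts. -/
lemma measureReal_sum_ge_le
    (hctx : ∀ τ ∈ Finset.Icc 1 T, Measurable (ctx τ) ∧ μ.map (ctx τ) = D)
    (hind : iIndepFun (fun τ : Finset.Icc 1 T => ctx τ) μ) (ht : t ∈ Finset.Icc 2 T)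
    {g : X → ℝ} (hg : Measurable g) {R : ℝ} (hR : ∀ x, |g x| ≤ R) {b : ℝ}
    (hb : ∫ x, Real.exp (g x) ∂D ≤ Real.exp b) (L : ℝ) :
    μ.real {ω | ((t : ℝ) - 1) * b + L ≤ ∑ τ ∈ Finset.Ico 1 t, g (ctx τ ω)} ≤ Real.exp (-L) := by
  rw [Finset.mem_Icc] at ht
  have hsub : ∀ τ ∈ Finset.Ico 1 t, τ ∈ Finset.Icc 1 T := fun τ hτ => by
    simp only [Finset.mem_Ico, Finset.mem_Icc] at hτ ⊢; omega
  let ι : Finset.Ico 1 t → Finset.Icc 1 T := fun τ => ⟨τ.1, hsub τ.1 τ.2⟩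
  have hι : Function.Injective ι := fun a b h => by
    have := congrArg Subtype.val h
    exact Subtype.ext this
  have hind' : iIndepFun (fun (τ : Finset.Ico 1 t) ω => g (ctx τ ω)) μ :=
    (hind.precomp hι).comp (fun _ => g) fun _ => hg
  have hmeas : ∀ τ : Finset.Ico 1 t, Measurable fun ω => g (ctx τ ω) := fun τ =>
    hg.comp (hctx τ.1 (hsub τ.1 τ.2)).1
  have hmgf := hind'.mgf_sum (t := 1) hmeas Finset.univ
  have hone : ∀ τ : Finset.Ico 1 t, mgf (fun ω => g (ctx τ ω)) μ 1 ≤ Real.exp b := fun τ => by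
    have h := hctx τ.1 (hsub τ.1 τ.2)
    rw [mgf]
    simp only [one_mul]
    have hm : Measurable fun x => Real.exp (g x) := Real.measurable_exp.comp hg
    rw [← h.2, integral_map h.1.aemeasurable hm.aestronglyMeasurable] at hb
    exact hb
  have hle : mgf (∑ τ : Finset.Ico 1 t, fun ω => g (ctx τ ω)) μ 1
      ≤ Real.exp (((t : ℝ) - 1) * b) := by
    rw [hmgf]
    calc ∏ τ : Finset.Ico 1 t, mgf (fun ω => g (ctx τ ω)) μ 1
        ≤ ∏ _τ : Finset.Ico 1 t, Real.exp b :=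
          Finset.prod_le_prod (fun _ _ => mgf_nonneg) fun τ _ => hone τ
      _ = _ := by
          rw [Finset.prod_const, ← Real.exp_nat_mul]
          simp [Nat.cast_sub (by omega : 1 ≤ t)]
  have hsum : (∑ τ : Finset.Ico 1 t, fun ω => g (ctx τ ω))
      = fun ω => ∑ τ ∈ Finset.Ico 1 t, g (ctx τ ω) := by
    funext ω
    rw [Finset.sum_apply]
    exact Finset.sum_coe_sort (Finset.Ico 1 t) fun τ => g (ctx τ ω)
  rw [hsum] at hle
  have hm : Measurable fun ω => ∑ τ ∈ Finset.Ico 1 t, g (ctx τ ω) :=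
    Finset.measurable_sum _ fun τ hτ => hg.comp (hctx τ (hsub τ hτ)).1
  have hInt : Integrable (fun ω => Real.exp (1 * ∑ τ ∈ Finset.Ico 1 t, g (ctx τ ω))) μ := by
    refine Integrable.of_bound
      (Real.measurable_exp.comp (hm.const_mul 1)).aestronglyMeasurable
      (Real.exp (∑ τ ∈ Finset.Ico 1 t, R)) (.of_forall fun ω => ?_)
    rw [Real.norm_eq_abs, Real.abs_exp, one_mul, Real.exp_le_exp]
    exact Finset.sum_le_sum fun τ _ => (le_abs_self _).trans (hR _)
  refine (measure_ge_le_exp_mul_mgf _ zero_le_one hInt).trans ?_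
  calc _ ≤ Real.exp (-1 * (((t : ℝ) - 1) * b + L)) * Real.exp (((t : ℝ) - 1) * b) := by gcongr
    _ = _ := by rw [← Real.exp_add]; ring_nf

variable [IsProbabilityMeasure D]

lemma integrable_of_abs_le {f : X → ℝ} (hf : Measurable f) {R : ℝ} (hR : ∀ x, |f x| ≤ R) :
    Integrable f D :=
  Integrable.of_bound hf.aestronglyMeasurable R (.of_forall hR)

/-- Integrate `exp g ≤ 1 + g + g²`, valid for `|g| ≤ 1`, then use `1 + s ≤ exp s`. -/
lemma integral_exp_le {g : X → ℝ} (hg : Measurable g) (hR : ∀ x, |g x| ≤ 1) :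
    ∫ x, Real.exp (g x) ∂D ≤ Real.exp (∫ x, g x ∂D + ∫ x, g x ^ 2 ∂D) := by
  have hi : Integrable g D := integrable_of_abs_le hg hR
  have hi2 : Integrable (fun x => g x ^ 2) D :=
    integrable_of_abs_le (hg.pow_const 2) (R := 1) fun x => by
      rw [abs_pow]; exact pow_le_one₀ (abs_nonneg _) (hR x)
  have hi1 : Integrable (fun x => 1 + g x) D := (integrable_const _).add hi
  calc ∫ x, Real.exp (g x) ∂D ≤ ∫ x, (1 + g x + g x ^ 2) ∂D := by
        refine integral_mono_of_nonneg (.of_forall fun x => (Real.exp_pos _).le)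
          (hi1.add hi2) (.of_forall fun x => ?_)
        have := (abs_le.mp (Real.abs_exp_sub_one_sub_id_le (hR x))).2
        simp only
        linarith
    _ = (∫ x, g x ∂D + ∫ x, g x ^ 2 ∂D) + 1 := by
        rw [integral_add hi1 hi2, integral_add (integrable_const _) hi]
        simp; ring
    _ ≤ _ := Real.add_one_le_exp _

/-- Multiplicative tail: since `0 ≤ ξ ≤ 2`, the second moment is at most twice the mean, so at
exponent `-1/4` the quadratic term consumes at most half of the linear one. -/
lemma measureReal_lower_tail_le
    (hctx : ∀ τ ∈ Finset.Icc 1 T, Measurable (ctx τ) ∧ μ.map (ctx τ) = D)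
    (hind : iIndepFun (fun τ : Finset.Icc 1 T => ctx τ) μ) (ht : t ∈ Finset.Icc 2 T)
    {ξ : X → ℝ} (hξ : Measurable ξ) (h0 : ∀ x, 0 ≤ ξ x) (h2 : ∀ x, ξ x ≤ 2) (q : ℝ) :
    μ.real {ω | ((t : ℝ) - 1)⁻¹ * ∑ τ ∈ Finset.Ico 1 t, ξ (ctx τ ω) + 20 * q
      ≤ (1 / 2) * ∫ x, ξ x ∂D} ≤ Real.exp (-(5 * (((t : ℝ) - 1) * q))) := by
  have hn : 0 < (t : ℝ) - 1 := by
    have : (2 : ℝ) ≤ t := by exact_mod_cast (Finset.mem_Icc.mp ht).1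
    linarith
  have hb1 : ∀ x, |-(1 / 4) * ξ x| ≤ 1 := fun x => by
    rw [abs_le]; constructor <;> linarith [h0 x, h2 x]
  have hb : ∫ x, Real.exp (-(1 / 4) * ξ x) ∂D ≤ Real.exp (-(1 / 8) * ∫ x, ξ x ∂D) := by
    refine (integral_exp_le (hξ.const_mul _) hb1).trans (Real.exp_le_exp.mpr ?_)
    rw [integral_const_mul]
    have hi : Integrable ξ D := integrable_of_abs_le hξ (R := 2) fun x => by
      rw [abs_of_nonneg (h0 x)]; exact h2 x
    have : ∫ x, (-(1 / 4) * ξ x) ^ 2 ∂D ≤ ∫ x, (1 / 8) * ξ x ∂D := by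
      refine integral_mono_of_nonneg (.of_forall fun x => sq_nonneg _) (hi.const_mul _)
        (.of_forall fun x => ?_)
      simp only
      nlinarith [h0 x, h2 x]
    rw [integral_const_mul] at this
    linarith
  refine le_trans (measureReal_mono fun ω hω => ?_)
    (measureReal_sum_ge_le hctx hind ht (hξ.const_mul _) hb1 hb (5 * (((t : ℝ) - 1) * q)))
  simp only [Set.mem_ofPred_eq, ← Finset.mul_sum] at hω ⊢
  have := mul_le_mul_of_nonneg_left hω hn.le
  rw [mul_add, mul_inv_cancel_left₀ hn.ne'] at this
  linarith

/-- Bernstein's inequality with variance proxy `2V`; adding `q` to `V` keeps the exponent `l` at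
most `1/2`, as `|ζ| ≤ 2` requires. -/
lemma measureReal_upper_tail_le
    (hctx : ∀ τ ∈ Finset.Icc 1 T, Measurable (ctx τ) ∧ μ.map (ctx τ) = D)
    (hind : iIndepFun (fun τ : Finset.Icc 1 T => ctx τ) μ) (ht : t ∈ Finset.Icc 2 T)
    {ζ : X → ℝ} (hζ : Measurable ζ) (h2 : ∀ x, |ζ x| ≤ 2) {V q : ℝ} (hV : 0 ≤ V)
    (hV2 : ∫ x, ζ x ^ 2 ∂D ≤ 2 * V) (hq : 0 < q) :
    μ.real {ω | 11 * √(q * (V + q)) ≤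
      ((t : ℝ) - 1)⁻¹ * ∑ τ ∈ Finset.Ico 1 t, ζ (ctx τ ω) - ∫ x, ζ x ∂D}
      ≤ Real.exp (-(5 * (((t : ℝ) - 1) * q))) := by
  have hn : 0 < (t : ℝ) - 1 := by
    have : (2 : ℝ) ≤ t := by exact_mod_cast (Finset.mem_Icc.mp ht).1
    linarith
  set s := √(q * (V + q)) with hs
  have hs2 : s * s = q * (V + q) := Real.mul_self_sqrt (by positivity)
  have hs0 : 0 < s := Real.sqrt_pos.mpr (by positivity)
  have hqs : q ≤ s := by
    by_contra h
    nlinarith [mul_nonneg hq.le hV]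
  set l := q / (2 * s) with hl
  have hl0 : 0 < l := by positivity
  have hls : l * s = q / 2 := by rw [hl]; field_simp
  have hl1 : l ≤ 1 / 2 := by
    -- Equivalent to `q ≤ s`.
    rw [hl, div_le_iff₀ (by positivity)]; linarith
  have hb1 : ∀ x, |l * ζ x| ≤ 1 := fun x => by
    rw [abs_mul, abs_of_pos hl0]
    nlinarith [h2 x, abs_nonneg (ζ x)]
  have hb : ∫ x, Real.exp (l * ζ x) ∂D ≤ Real.exp (l * ∫ x, ζ x ∂D + l ^ 2 * (2 * V)) := by
    refine (integral_exp_le (hζ.const_mul _) hb1).trans (Real.exp_le_exp.mpr ?_)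
    simp only [mul_pow, integral_const_mul]
    gcongr
  refine le_trans (measureReal_mono fun ω hω => ?_)
    (measureReal_sum_ge_le hctx hind ht (hζ.const_mul _) hb1 hb (5 * (((t : ℝ) - 1) * q)))
  simp only [Set.mem_ofPred_eq, ← Finset.mul_sum] at hω ⊢
  have hVl : l ^ 2 * (2 * V) ≤ q / 2 := by
    have h1 : (l * s) * (l * s) = q ^ 2 / 4 := by rw [hls]; ring
    have h2 : l ^ 2 * (q * (V + q)) = q ^ 2 / 4 := by rw [← hs2, ← h1]; ring
    have h3 : l ^ 2 * (V + q) = q / 4 := by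
      have : q * (l ^ 2 * (V + q)) = q * (q / 4) := by rw [← mul_left_comm, h2]; ring
      exact mul_left_cancel₀ hq.ne' this
    nlinarith [sq_nonneg l]
  have hω' : l * (11 * s) ≤ l * (((t : ℝ) - 1)⁻¹ * ∑ τ ∈ Finset.Ico 1 t, ζ (ctx τ ω)
      - ∫ x, ζ x ∂D) := mul_le_mul_of_nonneg_left hω hl0.le
  -- The constant `11` is used here: `l * 11s = 11q/2`, of which `q/2` pays for the variance and
  -- `5q` remains as the exponent.
  have h4 : l * ∫ x, ζ x ∂D + l ^ 2 * (2 * V) + 5 * q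
      ≤ ((t : ℝ) - 1)⁻¹ * (l * ∑ τ ∈ Finset.Ico 1 t, ζ (ctx τ ω)) := by
    have : l * (11 * s) = 11 / 2 * q := by linarith
    linarith
  have := mul_le_mul_of_nonneg_left h4 hn.le
  rw [mul_inv_cancel_left₀ hn.ne'] at this
  linarith

end Concentration

/-! ### Finite nets by gridding. -/

section Net

/-- A grid with mesh `1 / M` yields a finite subfamily approximating every member. -/
lemma exists_finset_net {Q I : Type*} [Fintype I] (φ : Q → I → ℝ) (hφ : ∀ f i, |φ f i| ≤ 1)
    {M : ℕ} (hM : 0 < M) :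
    ∃ F : Finset Q, F.card ≤ (2 * M + 1) ^ Fintype.card I ∧
      ∀ f, ∃ f' ∈ F, ∀ i, |φ f i - φ f' i| ≤ 1 / M := by
  classical
  have hM' : (0 : ℝ) < M := by exact_mod_cast hM
  let cell : Q → I → ℤ := fun f i => ⌊M * φ f i⌋
  let S : Finset (I → ℤ) := Fintype.piFinset fun _ => Finset.Icc (-(M : ℤ)) M
  have hcell : ∀ f, cell f ∈ S := fun f => by
    refine Fintype.mem_piFinset.mpr fun i => Finset.mem_Icc.mpr ?_
    obtain ⟨h1, h2⟩ := abs_le.mp (hφ f i)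
    refine ⟨Int.le_floor.mpr ?_, ?_⟩
    · push_cast; nlinarith
    · have : (⌊M * φ f i⌋ : ℝ) ≤ M := (Int.floor_le _).trans (by nlinarith)
      exact_mod_cast this
  let S' := S.filter fun z => ∃ f, cell f = z
  have hS' : ∀ z : S', ∃ f, cell f = z := fun z => (Finset.mem_filter.mp z.2).2
  -- One representative per occupied cell is taken from the family itself, so measurability and
  -- positivity hold at the net points.
  choose rep hrep using hS'
  refine ⟨Finset.univ.image rep, ?_, fun f => ?_⟩
  · calc (Finset.univ.image rep).card ≤ S'.card := by
          simpa using Finset.card_image_le (s := Finset.univ) (f := rep)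
      _ ≤ S.card := Finset.card_filter_le _ _
      _ = _ := by
          simp only [S, Fintype.card_piFinset, Int.card_Icc, Finset.prod_const, Finset.card_univ]
          congr 1
          omega
  · have hf : cell f ∈ S' := Finset.mem_filter.mpr ⟨hcell f, f, rfl⟩
    refine ⟨rep ⟨cell f, hf⟩, Finset.mem_image_of_mem _ (Finset.mem_univ _), fun i => ?_⟩
    have h := congrFun (hrep ⟨cell f, hf⟩) i
    have h' := Int.abs_sub_lt_one_of_floor_eq_floor h
    rw [← mul_sub, abs_mul, abs_of_pos hM'] at h'
    rw [abs_sub_comm, le_div_iff₀ hM']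
    linarith

end Net

/-! ### Bilinear forms of matrices, their means and sample averages. -/

section Matrices

variable {n : Type*} [Fintype n]

lemma dotProduct_mulVec_sq_le_of_posSemidef {A : Matrix n n ℝ} (hA : A.PosSemidef)
    (w v : n → ℝ) : (w ⬝ᵥ (A *ᵥ v)) ^ 2 ≤ (w ⬝ᵥ (A *ᵥ w)) * (v ⬝ᵥ (A *ᵥ v)) := by
  obtain ⟨C, rfl⟩ := exists_eq_conjTranspose_mul_self hA
  have h : ∀ u v : n → ℝ, u ⬝ᵥ ((Cᴴ * C) *ᵥ v) = (C *ᵥ u) ⬝ᵥ (C *ᵥ v) := fun u v => by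
    rw [← Matrix.mulVec_mulVec, Matrix.dotProduct_mulVec, Matrix.vecMul_conjTranspose]
    simp
  simp only [h]
  exact dotProduct_sq_le _ _

lemma dotProduct_mulVec_sq_le (A : Matrix n n ℝ) (w v : n → ℝ) :
    (w ⬝ᵥ (A *ᵥ v)) ^ 2 ≤ (∑ i, ∑ j, A i j ^ 2) * (w ⬝ᵥ w) * (v ⬝ᵥ v) := by
  have h1 := dotProduct_sq_le w (A *ᵥ v)
  have h2 : (A *ᵥ v) ⬝ᵥ (A *ᵥ v) ≤ (∑ i, ∑ j, A i j ^ 2) * (v ⬝ᵥ v) := by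
    rw [Finset.sum_mul]
    refine Finset.sum_le_sum fun i _ => ?_
    have := dotProduct_sq_le (A i) v
    simpa only [mulVec, dotProduct, ← sq] using this
  have := mul_le_mul_of_nonneg_left h2 (dotProduct_self_nonneg w)
  linarith

lemma abs_dotProduct_mulVec_le {A : Matrix n n ℝ} (hA : A.PosSemidef)
    (h2 : ∀ w : n → ℝ, w ⬝ᵥ (A *ᵥ w) ≤ 2 * (w ⬝ᵥ w)) (w v : n → ℝ) {a b : ℝ} (ha : 0 ≤ a)
    (hb : 0 ≤ b) (hw : w ⬝ᵥ w ≤ a ^ 2) (hv : v ⬝ᵥ v ≤ b ^ 2) :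
    |w ⬝ᵥ (A *ᵥ v)| ≤ 2 * (a * b) := by
  refine abs_le_of_sq_le_sq ?_ (by positivity)
  calc (w ⬝ᵥ (A *ᵥ v)) ^ 2 ≤ (w ⬝ᵥ (A *ᵥ w)) * (v ⬝ᵥ (A *ᵥ v)) :=
        dotProduct_mulVec_sq_le_of_posSemidef hA w v
    _ ≤ (2 * a ^ 2) * (2 * b ^ 2) := by
        refine mul_le_mul ((h2 w).trans ?_) ((h2 v).trans ?_)
          (dotProduct_mulVec_self_nonneg hA v) (by positivity)
        · linarith
        · linarith
    _ = _ := by ring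

/-- The bilinear form of a matrix bounded by `2 I` is stable under perturbation of all its
arguments. -/
lemma abs_dotProduct_mulVec_sub_le {A A' : Matrix n n ℝ} (hA' : A'.PosSemidef)
    (h2 : ∀ w : n → ℝ, w ⬝ᵥ (A' *ᵥ w) ≤ 2 * (w ⬝ᵥ w)) {w w' v v' : n → ℝ} {a b : ℝ}
    (ha : 0 ≤ a) (hb : 0 ≤ b) (hAA : ∑ i, ∑ j, (A i j - A' i j) ^ 2 ≤ a ^ 2)
    (hw : w ⬝ᵥ w ≤ 1) (hw' : w' ⬝ᵥ w' ≤ 1) (hv : v ⬝ᵥ v ≤ 1)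
    (hww : (w - w') ⬝ᵥ (w - w') ≤ b ^ 2) (hvv : (v - v') ⬝ᵥ (v - v') ≤ b ^ 2) :
    |w ⬝ᵥ (A *ᵥ v) - w' ⬝ᵥ (A' *ᵥ v')| ≤ a + 4 * b := by
  have e : w ⬝ᵥ (A *ᵥ v) - w' ⬝ᵥ (A' *ᵥ v') = w ⬝ᵥ ((A - A') *ᵥ v)
      + (w - w') ⬝ᵥ (A' *ᵥ v) + w' ⬝ᵥ (A' *ᵥ (v - v')) := by
    simp only [Matrix.sub_mulVec, Matrix.mulVec_sub, dotProduct_sub, sub_dotProduct]; ring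
  have h1 : |w ⬝ᵥ ((A - A') *ᵥ v)| ≤ a := by
    refine abs_le_of_sq_le_sq ?_ ha
    refine (dotProduct_mulVec_sq_le (A - A') w v).trans ?_
    have h0 : 0 ≤ ∑ i, ∑ j, (A i j - A' i j) ^ 2 := by positivity
    simp only [Matrix.sub_apply]
    calc _ ≤ (∑ i, ∑ j, (A i j - A' i j) ^ 2) * 1 * 1 := by
          gcongr
          exact dotProduct_self_nonneg v
      _ ≤ _ := by linarith
  have h2' := abs_dotProduct_mulVec_le hA' h2 (w - w') v hb zero_le_one hww (by simpa using hv)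
  have h3 := abs_dotProduct_mulVec_le hA' h2 w' (v - v') zero_le_one hb (by simpa using hw') hvv
  rw [e]
  have t1 := abs_add_le (w ⬝ᵥ ((A - A') *ᵥ v) + (w - w') ⬝ᵥ (A' *ᵥ v)) (w' ⬝ᵥ (A' *ᵥ (v - v')))
  have t2 := abs_add_le (w ⬝ᵥ ((A - A') *ᵥ v)) ((w - w') ⬝ᵥ (A' *ᵥ v))
  linarith

lemma measurable_dotProduct_mulVec {X : Type*} [MeasurableSpace X] {G : X → Matrix n n ℝ}
    (hG : ∀ i j, Measurable fun x => G x i j) (w v : n → ℝ) :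
    Measurable fun x => w ⬝ᵥ (G x *ᵥ v) := by
  simp only [dotProduct_mulVec_eq_sum]
  fun_prop

/-- The mean of a matrix-valued function. -/
noncomputable def popMat {X : Type*} [MeasurableSpace X] (D : Measure X) (G : X → Matrix n n ℝ) :
    Matrix n n ℝ := Matrix.of fun i j => ∫ x, G x i j ∂D

/-- The average of a matrix-valued function over the contexts `c 1, …, c (t - 1)`. -/
noncomputable def empMat {X : Type*} (c : ℕ → X) (t : ℕ) (G : X → Matrix n n ℝ) :
    Matrix n n ℝ := ((t : ℝ) - 1)⁻¹ • ∑ τ ∈ Finset.Ico 1 t, G (c τ)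

lemma dotProduct_popMat_mulVec {X : Type*} [MeasurableSpace X] {D : Measure X}
    {G : X → Matrix n n ℝ} (hG : ∀ i j, Integrable (fun x => G x i j) D) (w v : n → ℝ) :
    w ⬝ᵥ (popMat D G *ᵥ v) = ∫ x, w ⬝ᵥ (G x *ᵥ v) ∂D := by
  simp only [dotProduct_mulVec_eq_sum]
  rw [integral_finsetSum _ fun i _ => integrable_finsetSum _ fun j _ => (hG i j).const_mul _]
  refine Finset.sum_congr rfl fun i _ => ?_
  rw [integral_finsetSum _ fun j _ => (hG i j).const_mul _]
  exact Finset.sum_congr rfl fun j _ => by rw [integral_const_mul]; rfl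

lemma dotProduct_empMat_mulVec {X : Type*} (c : ℕ → X) (t : ℕ) (G : X → Matrix n n ℝ)
    (w v : n → ℝ) : w ⬝ᵥ (empMat c t G *ᵥ v) =
      ((t : ℝ) - 1)⁻¹ * ∑ τ ∈ Finset.Ico 1 t, w ⬝ᵥ (G (c τ) *ᵥ v) := by
  rw [empMat, Matrix.smul_mulVec, dotProduct_smul, smul_eq_mul, Matrix.sum_mulVec, dotProduct_sum]

lemma integrable_entry [DecidableEq n] {X : Type*} [MeasurableSpace X] {D : Measure X}
    [IsProbabilityMeasure D]
    {G : X → Matrix n n ℝ} (hG : ∀ i j, Measurable fun x => G x i j)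
    (hpsd : ∀ x, (G x).PosSemidef) (h2 : ∀ x (w : n → ℝ), w ⬝ᵥ (G x *ᵥ w) ≤ 2 * (w ⬝ᵥ w))
    (i j : n) : Integrable (fun x => G x i j) D := by
  refine integrable_of_abs_le (hG i j) (R := 2) fun x => ?_
  have := abs_dotProduct_mulVec_le (hpsd x) (h2 x) (Pi.single i 1) (Pi.single j 1)
    zero_le_one zero_le_one (by simp) (by simp)
  simpa using this

lemma abs_integral_sub_integral_le {X : Type*} [MeasurableSpace X] {D : Measure X}
    [IsProbabilityMeasure D] {f g : X → ℝ} (hf : Integrable f D) (hg : Integrable g D) {e : ℝ}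
    (h : ∀ x, |f x - g x| ≤ e) : |∫ x, f x ∂D - ∫ x, g x ∂D| ≤ e := by
  rw [← integral_sub hf hg]
  simpa using norm_integral_le_of_norm_le_const (μ := D) (f := fun x => f x - g x) (.of_forall h)

lemma abs_average_sub_average_le {X : Type*} (c : ℕ → X) {t : ℕ} (ht : 2 ≤ t) {f g : X → ℝ}
    {e : ℝ} (h : ∀ x, |f x - g x| ≤ e) :
    |((t : ℝ) - 1)⁻¹ * ∑ τ ∈ Finset.Ico 1 t, f (c τ)
      - ((t : ℝ) - 1)⁻¹ * ∑ τ ∈ Finset.Ico 1 t, g (c τ)| ≤ e := by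
  have hn : 0 < (t : ℝ) - 1 := by
    have : (2 : ℝ) ≤ t := by exact_mod_cast ht
    linarith
  rw [← mul_sub, ← Finset.sum_sub_distrib, abs_mul, abs_of_pos (inv_pos.mpr hn),
    inv_mul_le_iff₀ hn]
  calc |∑ τ ∈ Finset.Ico 1 t, (f (c τ) - g (c τ))| ≤ ∑ τ ∈ Finset.Ico 1 t, |f (c τ) - g (c τ)| :=
        Finset.abs_sum_le_sum_abs _ _
    _ ≤ ∑ _τ ∈ Finset.Ico 1 t, e := Finset.sum_le_sum fun τ _ => h _
    _ = _ := by simp [Nat.cast_sub (by omega : 1 ≤ t)]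

end Matrices

/-! ### Uniform concentration over parameters and directions. -/

section Uniform

variable {n : Type*} [Fintype n]

/-- Grid size for mesh `1 / (12kT³)` in `k²` parameter coordinates and `2k` direction coordinates.
The exponent `4k³` stays below the `5` in the tail bound, measured in units of `k³ log(3T/δ)`. -/
lemma net_card_le {k T : ℕ} (hk : 2 ≤ k) (hT : 1 ≤ T) :
    (2 * (12 * k * T ^ 3) + 1) ^ (k * k + (k + k)) ≤ (3 * T) ^ (4 * k ^ 3) := by
  have h9 : 25 * k ≤ 9 ^ k := by
    induction k, hk using Nat.le_induction with
    | base => norm_num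
    | succ m hm ih => rw [pow_succ]; omega
  have hT3 : 1 ≤ T ^ 3 := Nat.one_le_pow _ _ hT
  have h1 : 2 * (12 * k * T ^ 3) + 1 ≤ 9 ^ k * T ^ 3 := by
    calc 2 * (12 * k * T ^ 3) + 1 ≤ 25 * k * T ^ 3 := by nlinarith
      _ ≤ _ := Nat.mul_le_mul_right _ h9
  calc (2 * (12 * k * T ^ 3) + 1) ^ (k * k + (k + k)) ≤ (9 ^ k * T ^ 3) ^ (k * k + (k + k)) :=
        Nat.pow_le_pow_left h1 _
    _ ≤ (9 ^ k * T ^ 3) ^ (2 * k ^ 2) :=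
        Nat.pow_le_pow_right (Nat.mul_pos (by positivity) hT3) (by nlinarith)
    _ = 3 ^ (4 * k ^ 3) * T ^ (6 * k ^ 2) := by
        rw [mul_pow, ← pow_mul, ← pow_mul, show 9 = 3 ^ 2 by norm_num, ← pow_mul]
        congr 2 <;> ring
    _ ≤ 3 ^ (4 * k ^ 3) * T ^ (4 * k ^ 3) :=
        Nat.mul_le_mul_left _ (Nat.pow_le_pow_right hT (by nlinarith [sq_nonneg k]))
    _ = _ := by rw [mul_pow]

variable {X Ω : Type*} [MeasurableSpace X]

/-- The event that the sample average of the matrices `G` in the directions `w`, `v` deviates from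
its mean. -/
def deviationEvent (D : Measure X) (ctx : ℕ → Ω → X) (t : ℕ) (q : ℝ) (G : X → Matrix n n ℝ)
    (w v : n → ℝ) : Set Ω :=
  {ω | w ⬝ᵥ (empMat (fun τ => ctx τ ω) t G *ᵥ w) + 20 * q ≤ (1 / 2) * w ⬝ᵥ (popMat D G *ᵥ w)} ∪
    ({ω | 11 * √(q * (w ⬝ᵥ (popMat D G *ᵥ w) + q)) ≤
      w ⬝ᵥ (empMat (fun τ => ctx τ ω) t G *ᵥ v) - w ⬝ᵥ (popMat D G *ᵥ v)} ∪
    {ω | 11 * √(q * (w ⬝ᵥ (popMat D G *ᵥ w) + q)) ≤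
      w ⬝ᵥ (popMat D G *ᵥ v) - w ⬝ᵥ (empMat (fun τ => ctx τ ω) t G *ᵥ v)})

variable {D : Measure X} {ctx : ℕ → Ω → X} {T t : ℕ}

lemma sub_dotProduct_self_le {w w' : n → ℝ} {e : ℝ} (h : ∀ i, |w i - w' i| ≤ e) :
    (w - w') ⬝ᵥ (w - w') ≤ (Fintype.card n * e) ^ 2 := by
  by_cases hn : IsEmpty n
  · simp [dotProduct]
  rw [not_isEmpty_iff] at hn
  have hk : (1 : ℝ) ≤ Fintype.card n := by exact_mod_cast Fintype.card_pos
  calc (w - w') ⬝ᵥ (w - w') ≤ ∑ _i : n, e ^ 2 := by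
        refine Finset.sum_le_sum fun i _ => ?_
        rw [Pi.sub_apply, ← sq]
        exact sq_le_sq' (abs_le.mp (h i)).1 (abs_le.mp (h i)).2
    _ = Fintype.card n * e ^ 2 := by simp
    _ ≤ _ := by rw [mul_pow]; exact mul_le_mul_of_nonneg_right (by nlinarith) (sq_nonneg e)

/-- Outside the deviation event at a nearby point, the sample average is close to the mean. -/
lemma approx_of_notMem_deviationEvent [DecidableEq n] [IsProbabilityMeasure D]
    (ht : 2 ≤ t) {G G' : X → Matrix n n ℝ} (hG : ∀ i j, Measurable fun x => G x i j)
    (hpsd : ∀ x, (G x).PosSemidef) (h2 : ∀ x (w : n → ℝ), w ⬝ᵥ (G x *ᵥ w) ≤ 2 * (w ⬝ᵥ w))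
    (hG' : ∀ i j, Measurable fun x => G' x i j) (hpsd' : ∀ x, (G' x).PosSemidef)
    (h2' : ∀ x (w : n → ℝ), w ⬝ᵥ (G' x *ᵥ w) ≤ 2 * (w ⬝ᵥ w)) {w v w' v' : n → ℝ} {q e : ℝ}
    (hq : 0 < q) (heq : e ≤ q)
    (hww : ∀ x, |w ⬝ᵥ (G x *ᵥ w) - w' ⬝ᵥ (G' x *ᵥ w')| ≤ e)
    (hwv : ∀ x, |w ⬝ᵥ (G x *ᵥ v) - w' ⬝ᵥ (G' x *ᵥ v')| ≤ e) {ω : Ω}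
    (hω : ω ∉ deviationEvent D ctx t q G' w' v') :
    (1 / 2) * w ⬝ᵥ (popMat D G *ᵥ w)
        ≤ w ⬝ᵥ (empMat (fun τ => ctx τ ω) t G *ᵥ w) + 25 * q ∧
    (w ⬝ᵥ (empMat (fun τ => ctx τ ω) t G *ᵥ v) - w ⬝ᵥ (popMat D G *ᵥ v)) ^ 2
        ≤ 169 * q * (w ⬝ᵥ (popMat D G *ᵥ w) + 2 * q) := by
  have hInt := integrable_entry (D := D) hG hpsd h2
  have hInt' := integrable_entry (D := D) hG' hpsd' h2'
  have hi : ∀ (w v : n → ℝ), Integrable (fun x => w ⬝ᵥ (G x *ᵥ v)) D := fun w v => by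
    simp only [dotProduct_mulVec_eq_sum]
    exact integrable_finsetSum _ fun i _ => integrable_finsetSum _ fun j _ =>
      (hInt i j).const_mul _
  have hi' : ∀ (w v : n → ℝ), Integrable (fun x => w ⬝ᵥ (G' x *ᵥ v)) D := fun w v => by
    simp only [dotProduct_mulVec_eq_sum]
    exact integrable_finsetSum _ fun i _ => integrable_finsetSum _ fun j _ =>
      (hInt' i j).const_mul _
  have p1 := abs_integral_sub_integral_le (hi w w) (hi' w' w') hww
  have p2 := abs_integral_sub_integral_le (hi w v) (hi' w' v') hwv
  have e1 := abs_average_sub_average_le (fun τ => ctx τ ω) ht hww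
  have e2 := abs_average_sub_average_le (fun τ => ctx τ ω) ht hwv
  rw [← dotProduct_popMat_mulVec hInt, ← dotProduct_popMat_mulVec hInt'] at p1 p2
  rw [← dotProduct_empMat_mulVec (fun τ => ctx τ ω),
    ← dotProduct_empMat_mulVec (fun τ => ctx τ ω)] at e1 e2
  have hX : 0 ≤ w ⬝ᵥ (popMat D G *ᵥ w) := by
    rw [dotProduct_popMat_mulVec hInt]
    exact integral_nonneg fun x => dotProduct_mulVec_self_nonneg (hpsd x) w
  simp only [deviationEvent, Set.mem_union, Set.mem_ofPred_eq, not_or, not_le] at hω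
  obtain ⟨h1, h3, h4⟩ := hω
  rw [abs_le] at p1 p2 e1 e2
  refine ⟨by linarith, ?_⟩
  set V := w ⬝ᵥ (popMat D G *ᵥ w) with hV
  have hs : √(q * (w' ⬝ᵥ (popMat D G' *ᵥ w') + q)) ≤ √(q * (V + 2 * q)) :=
    Real.sqrt_le_sqrt (mul_le_mul_of_nonneg_left (by linarith) hq.le)
  set s := √(q * (V + 2 * q)) with hsdef
  have hs2 : s ^ 2 = q * (V + 2 * q) := Real.sq_sqrt (by positivity)
  have hqs : q ≤ s := Real.le_sqrt_of_sq_le (by nlinarith)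
  -- The deviation at the net point costs `11s` and the two perturbations cost `2e ≤ 2q ≤ 2s`, in
  -- total `13s`, whence `169`.
  have := sq_le_sq' (a := w ⬝ᵥ (empMat (fun τ => ctx τ ω) t G *ᵥ v) - w ⬝ᵥ (popMat D G *ᵥ v))
    (b := 13 * s) (by linarith) (by linarith)
  rw [mul_pow, hs2] at this
  linarith

variable [MeasurableSpace Ω] {μ : Measure Ω}

lemma measurable_dotProduct_empMat
    (hctx : ∀ τ ∈ Finset.Icc 1 T, Measurable (ctx τ) ∧ μ.map (ctx τ) = D)
    (ht : t ∈ Finset.Icc 2 T) {G : X → Matrix n n ℝ} (hG : ∀ i j, Measurable fun x => G x i j)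
    (w v : n → ℝ) : Measurable fun ω => w ⬝ᵥ (empMat (fun τ => ctx τ ω) t G *ᵥ v) := by
  simp only [dotProduct_empMat_mulVec]
  refine (Finset.measurable_sum _ fun τ hτ => ?_).const_mul _
  refine (measurable_dotProduct_mulVec hG w v).comp (hctx τ ?_).1
  simp only [Finset.mem_Ico, Finset.mem_Icc] at hτ ht ⊢
  omega

lemma measurableSet_deviationEvent
    (hctx : ∀ τ ∈ Finset.Icc 1 T, Measurable (ctx τ) ∧ μ.map (ctx τ) = D)
    (ht : t ∈ Finset.Icc 2 T) {G : X → Matrix n n ℝ} (hG : ∀ i j, Measurable fun x => G x i j)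
    (q : ℝ) (w v : n → ℝ) : MeasurableSet (deviationEvent D ctx t q G w v) := by
  have h := measurable_dotProduct_empMat hctx ht hG
  exact (measurableSet_le ((h w w).add_const _) measurable_const).union
    ((measurableSet_le measurable_const ((h w v).sub_const _)).union
      (measurableSet_le measurable_const ((h w v).const_sub _)))

variable [IsProbabilityMeasure μ]

/-- One lower tail for `w·Gw` and two one-sided tails for `±w·Gv`, which accounts for the factor
`3`. -/
lemma measureReal_deviationEvent_le [DecidableEq n] [IsProbabilityMeasure D]
    (hctx : ∀ τ ∈ Finset.Icc 1 T, Measurable (ctx τ) ∧ μ.map (ctx τ) = D)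
    (hind : iIndepFun (fun τ : Finset.Icc 1 T => ctx τ) μ) (ht : t ∈ Finset.Icc 2 T)
    {G : X → Matrix n n ℝ} (hG : ∀ i j, Measurable fun x => G x i j)
    (hpsd : ∀ x, (G x).PosSemidef) (h2 : ∀ x (w : n → ℝ), w ⬝ᵥ (G x *ᵥ w) ≤ 2 * (w ⬝ᵥ w))
    {q : ℝ} (hq : 0 < q) {w v : n → ℝ} (hw : w ⬝ᵥ w ≤ 1) (hv : v ⬝ᵥ v ≤ 1) :
    μ.real (deviationEvent D ctx t q G w v) ≤ 3 * Real.exp (-(5 * (((t : ℝ) - 1) * q))) := by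
  have hInt := integrable_entry (D := D) hG hpsd h2
  have hmw := measurable_dotProduct_mulVec hG w w
  have hmv := measurable_dotProduct_mulVec hG w v
  have hww : ∀ x, w ⬝ᵥ (G x *ᵥ w) ≤ 2 := fun x => (h2 x w).trans (by linarith)
  have hvv : ∀ x, v ⬝ᵥ (G x *ᵥ v) ≤ 2 := fun x => (h2 x v).trans (by linarith)
  have hnn : ∀ x, 0 ≤ w ⬝ᵥ (G x *ᵥ w) := fun x => dotProduct_mulVec_self_nonneg (hpsd x) w
  have hwv : ∀ x, |w ⬝ᵥ (G x *ᵥ v)| ≤ 2 := fun x => by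
    simpa using abs_dotProduct_mulVec_le (hpsd x) (h2 x) w v zero_le_one zero_le_one
      (by simpa using hw) (by simpa using hv)
  have hV : 0 ≤ ∫ x, w ⬝ᵥ (G x *ᵥ w) ∂D := integral_nonneg hnn
  -- Bounding the variance of `w·Gv` by the mean of `w·Gw`, rather than by a constant, is what later
  -- gives bounds in the local norm.
  have hV2 : ∫ x, (w ⬝ᵥ (G x *ᵥ v)) ^ 2 ∂D ≤ 2 * ∫ x, w ⬝ᵥ (G x *ᵥ w) ∂D := by
    rw [← integral_const_mul]
    refine integral_mono_of_nonneg (.of_forall fun x => sq_nonneg _)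
      ((integrable_of_abs_le hmw (R := 2) fun x => ?_).const_mul _) (.of_forall fun x => ?_)
    · rw [abs_of_nonneg (hnn x)]; exact hww x
    · refine (dotProduct_mulVec_sq_le_of_posSemidef (hpsd x) w v).trans ?_
      simp only
      nlinarith [hnn x, hvv x]
  have l := measureReal_lower_tail_le hctx hind ht hmw hnn hww q
  have u := measureReal_upper_tail_le hctx hind ht hmv hwv hV hV2 hq
  have u' := measureReal_upper_tail_le hctx hind ht (ζ := fun x => -(w ⬝ᵥ (G x *ᵥ v)))
    hmv.neg (fun x => by rw [abs_neg]; exact hwv x) hV (by simpa using hV2) hq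
  simp only [Finset.sum_neg_distrib, integral_neg, mul_neg, sub_neg_eq_add,
    neg_add_eq_sub] at u'
  simp only [← dotProduct_popMat_mulVec hInt, ← dotProduct_empMat_mulVec
    (fun τ => ctx τ _)] at l u u'
  have s1 := measureReal_union_le (μ := μ)
    {ω | w ⬝ᵥ (empMat (fun τ => ctx τ ω) t G *ᵥ w) + 20 * q ≤ (1 / 2) * w ⬝ᵥ (popMat D G *ᵥ w)}
    ({ω | 11 * √(q * (w ⬝ᵥ (popMat D G *ᵥ w) + q)) ≤
      w ⬝ᵥ (empMat (fun τ => ctx τ ω) t G *ᵥ v) - w ⬝ᵥ (popMat D G *ᵥ v)} ∪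
    {ω | 11 * √(q * (w ⬝ᵥ (popMat D G *ᵥ w) + q)) ≤
      w ⬝ᵥ (popMat D G *ᵥ v) - w ⬝ᵥ (empMat (fun τ => ctx τ ω) t G *ᵥ v)})
  have s2 := measureReal_union_le (μ := μ)
    {ω | 11 * √(q * (w ⬝ᵥ (popMat D G *ᵥ w) + q)) ≤
      w ⬝ᵥ (empMat (fun τ => ctx τ ω) t G *ᵥ v) - w ⬝ᵥ (popMat D G *ᵥ v)}
    {ω | 11 * √(q * (w ⬝ᵥ (popMat D G *ᵥ w) + q)) ≤
      w ⬝ᵥ (popMat D G *ᵥ v) - w ⬝ᵥ (empMat (fun τ => ctx τ ω) t G *ᵥ v)}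
  rw [deviationEvent]
  linarith

/-- Uniform concentration for a family of matrix-valued functions that depends in a Lipschitz way
on a matrix parameter with entries in `[-T², T²]`. -/
theorem exists_uniform_event [DecidableEq n] [IsProbabilityMeasure D] (hn : 2 ≤ Fintype.card n)
    (hT : 2 ≤ T) {δ : ℝ} (hδ : 0 < δ) (hδ1 : δ < 1)
    (hctx : ∀ τ ∈ Finset.Icc 1 T, Measurable (ctx τ) ∧ μ.map (ctx τ) = D)
    (hind : iIndepFun (fun τ : Finset.Icc 1 T => ctx τ) μ)
    {P : Type*} (G : P → X → Matrix n n ℝ) (θ : P → Matrix n n ℝ)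
    (hG : ∀ p i j, Measurable fun x => G p x i j) (hpsd : ∀ p x, (G p x).PosSemidef)
    (h2 : ∀ p x (w : n → ℝ), w ⬝ᵥ (G p x *ᵥ w) ≤ 2 * (w ⬝ᵥ w))
    (hθ : ∀ p i j, |θ p i j| ≤ (T : ℝ) ^ 2)
    (hlip : ∀ p p' x, ∑ i, ∑ j, (G p x i j - G p' x i j) ^ 2
      ≤ 64 * ∑ i, ∑ j, (θ p i j - θ p' i j) ^ 2) :
    ∃ E : Set Ω, MeasurableSet E ∧ ENNReal.ofReal (1 - δ) ≤ μ E ∧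
      ∀ ω ∈ E, ∀ t ∈ Finset.Icc 2 T, ∀ q : ℝ,
        q = (Fintype.card n : ℝ) ^ 3 * Real.log (3 * T / δ) / ((t : ℝ) - 1) →
        ∀ (p : P) (w v : n → ℝ), w ⬝ᵥ w ≤ 1 → v ⬝ᵥ v ≤ 1 →
          (1 / 2) * w ⬝ᵥ (popMat D (G p) *ᵥ w)
            ≤ w ⬝ᵥ (empMat (fun τ => ctx τ ω) t (G p) *ᵥ w) + 25 * q ∧
          (w ⬝ᵥ (empMat (fun τ => ctx τ ω) t (G p) *ᵥ v) - w ⬝ᵥ (popMat D (G p) *ᵥ v)) ^ 2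
            ≤ 169 * q * (w ⬝ᵥ (popMat D (G p) *ᵥ w) + 2 * q) := by
  classical
  set k := Fintype.card n with hk
  set Λ := Real.log (3 * T / δ) with hΛ
  have hTr : (2 : ℝ) ≤ T := by exact_mod_cast hT
  have hkr : (2 : ℝ) ≤ k := by exact_mod_cast hn
  have hexp : Real.exp Λ = 3 * T / δ := Real.exp_log (by positivity)
  have h3T : 3 * (T : ℝ) ≤ Real.exp Λ := by
    rw [hexp, le_div_iff₀ hδ]; nlinarith
  have hΛ1 : 1 ≤ Λ := by
    rw [← Real.exp_le_exp]
    linarith [Real.exp_one_lt_three]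
  set ℓ := (k : ℝ) ^ 3 * Λ with hℓ
  have hk3 : (8 : ℝ) ≤ (k : ℝ) ^ 3 := by
    calc (8 : ℝ) = 2 ^ 3 := by norm_num
      _ ≤ _ := by gcongr
  have hℓΛ : Λ ≤ ℓ := by rw [hℓ]; nlinarith
  let Q := P × {w : n → ℝ // w ⬝ᵥ w ≤ 1} × {w : n → ℝ // w ⬝ᵥ w ≤ 1}
  -- Grid coordinates, with the parameter rescaled by `T²` so that all of them lie in `[-1, 1]`.
  let φ : Q → (n × n) ⊕ (n ⊕ n) → ℝ := fun f =>
    Sum.elim (fun ij => θ f.1 ij.1 ij.2 / (T : ℝ) ^ 2) (Sum.elim f.2.1.1 f.2.2.1)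
  have hball : ∀ w : n → ℝ, w ⬝ᵥ w ≤ 1 → ∀ i, |w i| ≤ 1 := fun w hw i => by
    have : w i * w i ≤ w ⬝ᵥ w :=
      Finset.single_le_sum (f := fun i => w i * w i) (fun j _ => mul_self_nonneg (w j))
        (Finset.mem_univ i)
    exact abs_le_one_iff_mul_self_le_one.mpr (this.trans hw)
  have hφ : ∀ f i, |φ f i| ≤ 1 := by
    rintro f (ij | i | i)
    · simp only [φ, Sum.elim_inl]
      rw [abs_div, abs_of_nonneg (by positivity : (0:ℝ) ≤ (T : ℝ) ^ 2)]
      exact div_le_one_of_le₀ (hθ _ _ _) (by positivity)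
    · exact hball _ f.2.1.2 i
    · exact hball _ f.2.2.2 i
  -- Chosen so that the total perturbation, at most `8kT²/M + 4kT²/M`, equals `1/T`, which is at
  -- most `q`.
  set M := 12 * k * T ^ 3 with hM
  have hMpos : 0 < M := by positivity
  obtain ⟨F, hFcard, hF⟩ := exists_finset_net φ hφ hMpos
  have hqn : ∀ t ∈ Finset.Icc 2 T, 1 ≤ (t : ℝ) - 1 := fun t ht => by
    have : (2 : ℝ) ≤ t := by exact_mod_cast (Finset.mem_Icc.mp ht).1
    linarith
  let bad : ℕ → Q → Set Ω := fun t f =>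
    deviationEvent D ctx t (ℓ / ((t : ℝ) - 1)) (G f.1) f.2.1.1 f.2.2.1
  have hbadm : ∀ t ∈ Finset.Icc 2 T, ∀ f, MeasurableSet (bad t f) := fun t ht f =>
    measurableSet_deviationEvent hctx ht (hG f.1) _ _ _
  have hB : MeasurableSet (⋃ t ∈ Finset.Icc 2 T, ⋃ f ∈ F, bad t f) :=
    Finset.measurableSet_biUnion _ fun t ht => Finset.measurableSet_biUnion _ fun f _ =>
      hbadm t ht f
  have hbadμ : ∀ t ∈ Finset.Icc 2 T, ∀ f, μ.real (bad t f) ≤ 3 * Real.exp (-(5 * ℓ)) := by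
    intro t ht f
    have hn0 := hqn t ht
    refine (measureReal_deviationEvent_le hctx hind ht (hG f.1) (hpsd f.1) (h2 f.1)
      (q := ℓ / ((t : ℝ) - 1)) (by positivity) f.2.1.2 f.2.2.2).trans_eq ?_
    rw [mul_div_cancel₀ _ (by positivity)]
  have hcard : (F.card : ℝ) ≤ Real.exp (4 * ℓ) := by
    have h1 : F.card ≤ (3 * T) ^ (4 * k ^ 3) := by
      refine hFcard.trans ?_
      have := net_card_le hn (by omega : 1 ≤ T)
      simpa [Fintype.card_sum, Fintype.card_prod, ← hk, hM] using this
    calc (F.card : ℝ) ≤ (3 * (T : ℝ)) ^ (4 * k ^ 3) := by exact_mod_cast h1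
      _ ≤ (Real.exp Λ) ^ (4 * k ^ 3) := by gcongr
      _ = _ := by rw [← Real.exp_nat_mul, hℓ]; push_cast; ring_nf
  -- Union bound over fewer than `T` rounds and at most `exp(4ℓ)` net points; the surplus `exp(-ℓ) ≤
  -- exp(-Λ)` absorbs `3T`.
  have hBμ : μ.real (⋃ t ∈ Finset.Icc 2 T, ⋃ f ∈ F, bad t f) ≤ δ := by
    calc μ.real (⋃ t ∈ Finset.Icc 2 T, ⋃ f ∈ F, bad t f)
        ≤ ∑ t ∈ Finset.Icc 2 T, μ.real (⋃ f ∈ F, bad t f) := measureReal_biUnion_finset_le _ _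
      _ ≤ ∑ t ∈ Finset.Icc 2 T, ∑ f ∈ F, μ.real (bad t f) :=
          Finset.sum_le_sum fun t _ => measureReal_biUnion_finset_le _ _
      _ ≤ ∑ t ∈ Finset.Icc 2 T, ∑ f ∈ F, 3 * Real.exp (-(5 * ℓ)) :=
          Finset.sum_le_sum fun t ht => Finset.sum_le_sum fun f _ => hbadμ t ht f
      _ = ((T - 1 : ℕ) : ℝ) * (F.card * (3 * Real.exp (-(5 * ℓ)))) := by
          simp
      _ ≤ T * (Real.exp (4 * ℓ) * (3 * Real.exp (-(5 * ℓ)))) := by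
          gcongr
          exact Nat.sub_le _ _
      _ = 3 * T * Real.exp (-ℓ) := by
          have : Real.exp (4 * ℓ) * Real.exp (-(5 * ℓ)) = Real.exp (-ℓ) := by
            rw [← Real.exp_add]; ring_nf
          rw [← this]; ring
      _ ≤ 3 * T * Real.exp (-Λ) := by gcongr
      _ = δ := by rw [Real.exp_neg, hexp]; field_simp
  refine ⟨(⋃ t ∈ Finset.Icc 2 T, ⋃ f ∈ F, bad t f)ᶜ, hB.compl, ?_, ?_⟩
  · rw [← ofReal_measureReal, probReal_compl_eq_one_sub hB]
    exact ENNReal.ofReal_le_ofReal (by linarith)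
  · intro ω hω t ht q hq p w v hw hv
    have hn0 := hqn t ht
    obtain ⟨f, hfF, hf⟩ := hF (p, ⟨w, hw⟩, ⟨v, hv⟩)
    have hnot : ω ∉ bad t f := fun h => hω (by
      simp only [Set.mem_iUnion]
      exact ⟨t, ht, f, hfF, h⟩)
    have hq' : q = ℓ / ((t : ℝ) - 1) := hq
    have hM' : (M : ℝ) = 12 * k * T ^ 3 := by rw [hM]; push_cast; ring
    have hfw : ∀ i, |w i - f.2.1.1 i| ≤ 1 / M := fun i => hf (.inr (.inl i))
    have hfv : ∀ i, |v i - f.2.2.1 i| ≤ 1 / M := fun i => hf (.inr (.inr i))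
    have hfθ : ∀ i j, |θ p i j - θ f.1 i j| ≤ (T : ℝ) ^ 2 / M := fun i j => by
      have h := hf (.inl (i, j))
      simp only [φ, Sum.elim_inl] at h
      rw [← sub_div, abs_div, abs_of_pos (by positivity : (0:ℝ) < (T : ℝ) ^ 2),
        div_le_iff₀ (by positivity)] at h
      linarith [show 1 / (M : ℝ) * T ^ 2 = T ^ 2 / M by ring]
    have hGG : ∀ x, ∑ i, ∑ j, (G p x i j - G f.1 x i j) ^ 2
        ≤ (8 * (k * ((T : ℝ) ^ 2 / M))) ^ 2 := fun x => by
      refine (hlip p f.1 x).trans ?_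
      calc 64 * ∑ i, ∑ j, (θ p i j - θ f.1 i j) ^ 2
          ≤ 64 * ∑ _i : n, ∑ _j : n, ((T : ℝ) ^ 2 / M) ^ 2 := by
            refine mul_le_mul_of_nonneg_left (Finset.sum_le_sum fun i _ =>
              Finset.sum_le_sum fun j _ => ?_) (by norm_num)
            exact sq_le_sq' (abs_le.mp (hfθ i j)).1 (abs_le.mp (hfθ i j)).2
        _ = _ := by simp [← hk]; ring
    have hww := sub_dotProduct_self_le hfw
    have hvv := sub_dotProduct_self_le hfv
    rw [← hk] at hww hvv
    have hqT : 1 / (T : ℝ) ≤ q := by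
      rw [hq', div_le_div_iff₀ (by positivity) (by positivity)]
      have h1 : (t : ℝ) ≤ T := by exact_mod_cast (Finset.mem_Icc.mp ht).2
      nlinarith
    have he : 8 * (k * ((T : ℝ) ^ 2 / M)) + 4 * (k * (1 / M)) ≤ q := by
      refine le_trans ?_ hqT
      have hT2 : (1 : ℝ) ≤ (T : ℝ) ^ 2 := by nlinarith
      calc 8 * (k * ((T : ℝ) ^ 2 / M)) + 4 * (k * (1 / M))
          ≤ 8 * (k * ((T : ℝ) ^ 2 / M)) + 4 * (k * ((T : ℝ) ^ 2 / M)) := by gcongr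
        _ = 1 / (T : ℝ) := by rw [hM']; field_simp; norm_num
    have hq0 : 0 < q := by rw [hq']; positivity
    refine approx_of_notMem_deviationEvent (Finset.mem_Icc.mp ht).1 (hG p) (hpsd p) (h2 p)
      (hG f.1) (hpsd f.1) (h2 f.1) hq0 he (fun x => ?_) (fun x => ?_)
      (by rw [hq']; exact hnot)
    · exact abs_dotProduct_mulVec_sub_le (hpsd f.1 x) (h2 f.1 x) (by positivity) (by positivity)
        (hGG x) hw f.2.1.2 hw hww hww
    · exact abs_dotProduct_mulVec_sub_le (hpsd f.1 x) (h2 f.1 x) (by positivity) (by positivity)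
        (hGG x) hw f.2.1.2 hv hww hvv

end Uniform

/-! ### Extension from the unit ball to all vectors by scaling. -/

section Homogeneity

variable {n : Type*} [Fintype n]

lemma exists_smul_of_dotProduct_self_pos {w : n → ℝ} (hw : 0 < w ⬝ᵥ w) :
    ∃ (r : ℝ) (u : n → ℝ), w = r • u ∧ u ⬝ᵥ u = 1 := by
  have hr : 0 < √(w ⬝ᵥ w) := Real.sqrt_pos.mpr hw
  have hr2 : √(w ⬝ᵥ w) * √(w ⬝ᵥ w) = w ⬝ᵥ w := Real.mul_self_sqrt hw.le
  refine ⟨√(w ⬝ᵥ w), (√(w ⬝ᵥ w))⁻¹ • w, ?_, ?_⟩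
  · rw [smul_smul, mul_inv_cancel₀ hr.ne', one_smul]
  · rw [smul_dotProduct, dotProduct_smul, smul_eq_mul, smul_eq_mul]
    nth_rewrite 3 [← hr2]
    field_simp

lemma eq_zero_of_dotProduct_self_nonpos {w : n → ℝ} (hw : ¬ 0 < w ⬝ᵥ w) : w = 0 :=
  dotProduct_self_eq_zero.mp (le_antisymm (not_lt.mp hw) (dotProduct_self_nonneg w))

/-- Scaling is needed because centering can send a unit vector to one of squared norm up to `2`. -/
lemma half_le_of_unit {A B : Matrix n n ℝ} {s : ℝ}
    (h : ∀ w : n → ℝ, w ⬝ᵥ w ≤ 1 → (1 / 2) * w ⬝ᵥ (A *ᵥ w) ≤ w ⬝ᵥ (B *ᵥ w) + s) (w : n → ℝ) :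
    (1 / 2) * w ⬝ᵥ (A *ᵥ w) ≤ w ⬝ᵥ (B *ᵥ w) + s * (w ⬝ᵥ w) := by
  by_cases hw : 0 < w ⬝ᵥ w
  · obtain ⟨r, u, rfl, hu⟩ := exists_smul_of_dotProduct_self_pos hw
    have := mul_le_mul_of_nonneg_left (h u hu.le) (sq_nonneg r)
    simp only [Matrix.mulVec_smul, dotProduct_smul, smul_dotProduct, smul_eq_mul, hu]
    linarith
  · simp [eq_zero_of_dotProduct_self_nonpos hw]

lemma sq_sub_le_of_unit {A B : Matrix n n ℝ} {K s : ℝ}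
    (h : ∀ w v : n → ℝ, w ⬝ᵥ w ≤ 1 → v ⬝ᵥ v ≤ 1 →
      (w ⬝ᵥ (B *ᵥ v) - w ⬝ᵥ (A *ᵥ v)) ^ 2 ≤ K * (w ⬝ᵥ (A *ᵥ w) + s)) (w v : n → ℝ) :
    (w ⬝ᵥ (B *ᵥ v) - w ⬝ᵥ (A *ᵥ v)) ^ 2
      ≤ K * (v ⬝ᵥ v) * (w ⬝ᵥ (A *ᵥ w) + s * (w ⬝ᵥ w)) := by
  by_cases hw : 0 < w ⬝ᵥ w
  · by_cases hv : 0 < v ⬝ᵥ v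
    · obtain ⟨r, u, rfl, hu⟩ := exists_smul_of_dotProduct_self_pos hw
      obtain ⟨r', u', rfl, hu'⟩ := exists_smul_of_dotProduct_self_pos hv
      have := mul_le_mul_of_nonneg_left (h u u' hu.le hu'.le) (sq_nonneg (r * r'))
      simp only [Matrix.mulVec_smul, dotProduct_smul, smul_dotProduct, smul_eq_mul, hu, hu']
      linarith
    · simp [eq_zero_of_dotProduct_self_nonpos hv]
  · simp [eq_zero_of_dotProduct_self_nonpos hw]

end Homogeneity

/-! ### Centered moments as linear images of lifted ones. -/

section Recentering

variable {d : ℕ}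

/-- The matrix of the map `(a, 1) ↦ a - v`. -/
def centering (v : Fin d → ℝ) : Matrix (Fin d) (Fin d ⊕ Unit) ℝ :=
  Matrix.of fun i => Sum.elim (Pi.single i 1) fun _ => -v i

lemma centering_dotProduct_lift (v : Fin d → ℝ) (i : Fin d) (a : Action d) :
    centering v i ⬝ᵥ lift a = a i - v i := by
  simp [centering, dotProduct, lift, Pi.single_apply, sub_eq_add_neg]

lemma mul_mul_transpose_apply {m n : Type*} [Fintype n] (R : Matrix m n ℝ) (M : Matrix n n ℝ)
    (i j : m) : (R * M * Rᵀ) i j = R i ⬝ᵥ (M *ᵥ R j) := by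
  rw [Matrix.mul_assoc, Matrix.mul_apply']
  congr 1

lemma dotProduct_mul_mul_transpose_mulVec {m n : Type*} [Fintype m] [Fintype n]
    (R : Matrix m n ℝ) (M : Matrix n n ℝ) (z y : m → ℝ) :
    z ⬝ᵥ ((R * M * Rᵀ) *ᵥ y) = (Rᵀ *ᵥ z) ⬝ᵥ (M *ᵥ (Rᵀ *ᵥ y)) := by
  rw [← Matrix.mulVec_mulVec, ← Matrix.mulVec_mulVec, Matrix.dotProduct_mulVec,
    Matrix.mulVec_transpose R z]

/-- Holds because `a - v = R (a, 1)` with `R = centering v`; the center thereby moves from the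
moment into the test vectors. -/
lemma secondMoment_eq {ν : Measure (Action d)} [IsFiniteMeasure ν] (hν : ∀ᵐ a ∂ν, ‖a‖ ≤ 1)
    (v : Fin d → ℝ) : secondMoment ν v = centering v * liftedCov ν * (centering v)ᵀ := by
  ext i j
  rw [mul_mul_transpose_apply, dotProduct_liftedCov_mulVec hν]
  simp only [centering_dotProduct_lift, secondMoment, of_apply]

lemma centering_transpose_mulVec (v z : Fin d → ℝ) :
    (centering v)ᵀ *ᵥ z = Sum.elim z fun _ => -(z ⬝ᵥ v) := by
  ext (i | i)
  · simp [centering, mulVec, dotProduct, Pi.single_apply]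
  · simp [centering, mulVec, dotProduct, mul_comm]

lemma mean_eq (ν : Measure (Action d)) (i : Fin d) :
    mean ν i = liftedCov ν (Sum.inl i) (Sum.inr ()) := by
  simp [mean, liftedCov, lift]

lemma abs_dotProduct_mean_le {ν : Measure (Action d)} [IsProbabilityMeasure ν]
    (hν : ∀ᵐ a ∂ν, ‖a‖ ≤ 1) (z : Fin d → ℝ) : |z ⬝ᵥ mean ν| ≤ √(z ⬝ᵥ z) := by
  have e : z ⬝ᵥ mean ν = ∫ a, z ⬝ᵥ (fun i => a i) ∂ν := by
    simp only [dotProduct]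
    rw [integral_finsetSum]
    · exact Finset.sum_congr rfl fun i _ => by rw [integral_const_mul]; rfl
    · intro i _
      have := integrable_lift_mul_lift hν (Sum.inl i) (Sum.inr ())
      simp only [lift, Sum.elim_inl, Sum.elim_inr, mul_one] at this
      exact this.const_mul _
  rw [e]
  have := norm_integral_le_of_norm_le_const (μ := ν) (f := fun a => z ⬝ᵥ (fun i => a i))
    (C := √(z ⬝ᵥ z)) (by
      filter_upwards [hν] with a ha
      refine Real.abs_le_sqrt ((dotProduct_sq_le z _).trans ?_)
      have h1 : (fun i => a i) ⬝ᵥ (fun i => a i) = ‖a‖ ^ 2 := by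
        simp [dotProduct, EuclideanSpace.norm_sq_eq, ← sq]
      rw [h1]
      exact mul_le_of_le_one_right (dotProduct_self_nonneg z)
        (pow_le_one₀ (norm_nonneg a) ha))
  simpa using this

variable {X : Type*} [MeasurableSpace X] {D : Measure X} {p : Kernel X (Action d)}
  {c : ℕ → X} {t : ℕ}

lemma popMean_eq (i : Fin d) : popMean D p i = popLifted D p (Sum.inl i) (Sum.inr ()) := by
  simp [popMean, popLifted, mean_eq]

lemma empMean_eq (i : Fin d) : empMean c t p i = empLifted c t p (Sum.inl i) (Sum.inr ()) := by
  simp [empMean, empLifted, mean_eq, Matrix.sum_apply]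

variable [IsMarkovKernel p]

lemma dotProduct_empMean_sq_le (hp : ∀ x, ∀ᵐ a ∂p x, ‖a‖ ≤ 1) (ht : 2 ≤ t) (z : Fin d → ℝ) :
    (z ⬝ᵥ empMean c t p) ^ 2 ≤ z ⬝ᵥ z := by
  have h : |z ⬝ᵥ empMean c t p| ≤ √(z ⬝ᵥ z) := by
    have := abs_average_sub_average_le c ht (f := fun x => z ⬝ᵥ mean (p x)) (g := 0)
      (e := √(z ⬝ᵥ z)) fun x => by simpa using abs_dotProduct_mean_le (hp x) z
    rw [empMean, dotProduct_smul, dotProduct_sum, smul_eq_mul]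
    simpa using this
  calc (z ⬝ᵥ empMean c t p) ^ 2 = |z ⬝ᵥ empMean c t p| ^ 2 := (sq_abs _).symm
    _ ≤ √(z ⬝ᵥ z) ^ 2 := by gcongr
    _ = _ := Real.sq_sqrt (dotProduct_self_nonneg z)

/-- The image is `(z, -z·x̂)`, and `‖x̂‖ ≤ 1`. -/
lemma centering_transpose_mulVec_dotProduct_self_le (hp : ∀ x, ∀ᵐ a ∂p x, ‖a‖ ≤ 1) (ht : 2 ≤ t)
    (z : Fin d → ℝ) :
    ((centering (empMean c t p))ᵀ *ᵥ z) ⬝ᵥ ((centering (empMean c t p))ᵀ *ᵥ z)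
      ≤ 2 * (z ⬝ᵥ z) := by
  have := dotProduct_empMean_sq_le (c := c) hp ht z
  rw [centering_transpose_mulVec]
  simp only [dotProduct, Fintype.sum_sum_type, Sum.elim_inl, Sum.elim_inr, Finset.univ_unique,
    Finset.sum_singleton] at this ⊢
  linarith

lemma empCov_eq (hp : ∀ x, ∀ᵐ a ∂p x, ‖a‖ ≤ 1) :
    empCov c t p =
      centering (empMean c t p) * empLifted c t p * (centering (empMean c t p))ᵀ := by
  simp only [empCov, empLifted, secondMoment_eq (hp _), Matrix.mul_smul, Matrix.smul_mul,
    Matrix.mul_sum, Matrix.sum_mul]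

variable [IsProbabilityMeasure D]

lemma popCov_eq (hp : ∀ x, ∀ᵐ a ∂p x, ‖a‖ ≤ 1) :
    popCov D c t p =
      centering (empMean c t p) * popLifted D p * (centering (empMean c t p))ᵀ := by
  have hInt := integrable_entry (D := D) (measurable_liftedCov p)
    (fun x => posSemidef_liftedCov (hp x)) (fun x => dotProduct_liftedCov_mulVec_self_le (hp x))
  ext i j
  rw [mul_mul_transpose_apply]
  refine Eq.trans ?_ (dotProduct_popMat_mulVec hInt _ _).symm
  simp only [popCov, of_apply, secondMoment_eq (hp _), mul_mul_transpose_apply]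

lemma liftedCov_inr_inr (ν : Measure (Action d)) [IsProbabilityMeasure ν] :
    liftedCov ν (Sum.inr ()) (Sum.inr ()) = 1 := by
  simp [liftedCov, lift]

lemma empLifted_inr_inr (ht : 2 ≤ t) : empLifted c t p (Sum.inr ()) (Sum.inr ()) = 1 := by
  have hn : (t : ℝ) - 1 ≠ 0 := by
    have : (2 : ℝ) ≤ t := by exact_mod_cast ht
    linarith
  simp [empLifted, Matrix.sum_apply, liftedCov_inr_inr, Nat.cast_sub (by omega : 1 ≤ t), hn]

lemma popLifted_inr_inr : popLifted D p (Sum.inr ()) (Sum.inr ()) = 1 := by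
  simp [popLifted, liftedCov_inr_inr]

/-- The last column of a lifted matrix is (mean, 1). The corner entries agree, so the centering
terms cancel and the mean error becomes a bilinear deviation with `v = (0, 1)`. -/
lemma centering_dotProduct_sub_single (ht : 2 ≤ t) (z : Fin d → ℝ) :
    ((centering (empMean c t p))ᵀ *ᵥ z) ⬝ᵥ (empLifted c t p *ᵥ Pi.single (Sum.inr ()) 1)
      - ((centering (empMean c t p))ᵀ *ᵥ z) ⬝ᵥ (popLifted D p *ᵥ Pi.single (Sum.inr ()) 1)
      = z ⬝ᵥ (empMean c t p - popMean D p) := by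
  rw [centering_transpose_mulVec, dotProduct_sub]
  simp only [dotProduct, Fintype.sum_sum_type, mulVec_single_one, col_apply, Sum.elim_inl,
    Sum.elim_inr, Finset.univ_unique, Finset.sum_singleton, PUnit.default_eq_unit,
    empLifted_inr_inr ht, popLifted_inr_inr, empMean_eq, popMean_eq]
  ring

end Recentering

/-! ### From directional deviations to local norms. -/

section Bounds

variable {d : ℕ}

/-- Duality of the norms of `M` and `M⁻¹`: the test vector `z = M⁻¹ u` gives `N² ≤ B N` for `N =
sqNorm M⁻¹ u`. -/
lemma sqNorm_inv_le {M : Matrix (Fin d) (Fin d) ℝ} (hM : M.PosDef) {u : Fin d → ℝ} {B : ℝ}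
    (hB : 0 ≤ B) (h : ∀ z : Fin d → ℝ, (z ⬝ᵥ u) ^ 2 ≤ B * (z ⬝ᵥ (M *ᵥ z))) :
    sqNorm M⁻¹ u ≤ B := by
  have hu : IsUnit M.det := (Matrix.isUnit_iff_isUnit_det _).mp hM.isUnit
  have h1 := h (M⁻¹ *ᵥ u)
  rw [Matrix.mulVec_mulVec, Matrix.mul_nonsing_inv _ hu, Matrix.one_mulVec,
    dotProduct_comm] at h1
  rw [sqNorm]
  by_contra! hlt
  nlinarith

lemma dotProduct_sigma_mulVec (A : Matrix (Fin d) (Fin d) ℝ) (β : ℝ) (z y : Fin d → ℝ) :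
    z ⬝ᵥ ((A + β • (1 : Matrix (Fin d) (Fin d) ℝ)) *ᵥ y)
      = z ⬝ᵥ (A *ᵥ y) + β * (z ⬝ᵥ y) := by
  rw [Matrix.add_mulVec, Matrix.smul_mulVec, Matrix.one_mulVec, dotProduct_add, dotProduct_smul,
    smul_eq_mul]

lemma posSemidef_add_smul_sub_half {n : Type*} [Fintype n] [DecidableEq n] {A B : Matrix n n ℝ}
    (hA : A.IsHermitian) (hB : B.IsHermitian) {s : ℝ}
    (h : ∀ w : n → ℝ, (1 / 2) * w ⬝ᵥ (A *ᵥ w) ≤ w ⬝ᵥ (B *ᵥ w) + s * (w ⬝ᵥ w)) :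
    (B + s • (1 : Matrix n n ℝ) - (1 / 2 : ℝ) • A).PosSemidef := by
  refine Matrix.PosSemidef.of_dotProduct_mulVec_nonneg
    ((hB.add (Matrix.isHermitian_one.smul (IsSelfAdjoint.all s))).sub
      (hA.smul (IsSelfAdjoint.all _))) fun w => ?_
  have := h w
  simp only [star_trivial, Matrix.sub_mulVec, Matrix.add_mulVec, Matrix.smul_mulVec,
    Matrix.one_mulVec, dotProduct_sub, dotProduct_add, dotProduct_smul, smul_eq_mul]
  linarith

/-- From uniform deviation bounds in fixed directions to bounds in the local norm. -/
lemma sqNorm_bounds {c₁ c₂ β q : ℝ} (hc₁ : 0 < c₁) (hβ : 0 < β) (hq : 0 < q)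
    (hβ₁ : q ≤ 3 * β / c₁) (hβ₂ : β ≤ c₂ * q) {A B : Matrix (Fin d) (Fin d) ℝ} {u : Fin d → ℝ}
    (hB : B.PosSemidef)
    (h1 : ∀ z y : Fin d → ℝ, (z ⬝ᵥ (B *ᵥ y) - z ⬝ᵥ (A *ᵥ y)) ^ 2
      ≤ 338 * q * (y ⬝ᵥ y) * (2 * z ⬝ᵥ (B *ᵥ z) + 104 * q * (z ⬝ᵥ z)))
    (h2 : ∀ z : Fin d → ℝ, (z ⬝ᵥ u) ^ 2
      ≤ 338 * q * (2 * z ⬝ᵥ (B *ᵥ z) + 104 * q * (z ⬝ᵥ z))) :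
    (∀ y : Fin d → ℝ, y ⬝ᵥ y ≤ 1 → sqNorm (B + β • (1 : Matrix (Fin d) (Fin d) ℝ))⁻¹
      ((B + β • (1 : Matrix (Fin d) (Fin d) ℝ) - A) *ᵥ y)
        ≤ (2 * c₂ + 676 * (2 + 312 / c₁)) * q) ∧
    sqNorm (B + β • (1 : Matrix (Fin d) (Fin d) ℝ))⁻¹ u
      ≤ (2 * c₂ + 676 * (2 + 312 / c₁)) * q := by
  have hpd : (B + β • (1 : Matrix (Fin d) (Fin d) ℝ)).PosDef :=
    Matrix.PosDef.posSemidef_add hB (Matrix.PosDef.one.smul hβ)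
  have hc₂ : 0 < c₂ := by
    by_contra! h
    nlinarith
  -- The regularizer `β` absorbs the additive error `104q`; `312 = 3 * 104` comes from `q ≤ 3β/c₁`.
  have hκ : ∀ z : Fin d → ℝ, 2 * z ⬝ᵥ (B *ᵥ z) + 104 * q * (z ⬝ᵥ z)
      ≤ (2 + 312 / c₁) * (z ⬝ᵥ (B *ᵥ z) + β * (z ⬝ᵥ z)) := fun z => by
    have hz := dotProduct_self_nonneg z
    have hBz := dotProduct_mulVec_self_nonneg hB z
    have e1 : 0 ≤ 312 / c₁ * z ⬝ᵥ (B *ᵥ z) := by positivity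
    have e2 : 0 ≤ 2 * β * (z ⬝ᵥ z) := by positivity
    have e3 : 104 * q * (z ⬝ᵥ z) ≤ 312 / c₁ * (β * (z ⬝ᵥ z)) := by
      calc 104 * q * (z ⬝ᵥ z) ≤ 104 * (3 * β / c₁) * (z ⬝ᵥ z) := by gcongr
        _ = _ := by ring
    linarith
  have hS : ∀ z : Fin d → ℝ, 0 ≤ z ⬝ᵥ (B *ᵥ z) + β * (z ⬝ᵥ z) := fun z =>
    add_nonneg (dotProduct_mulVec_self_nonneg hB z)
      (mul_nonneg hβ.le (dotProduct_self_nonneg z))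
  have hK : 0 ≤ (2 * c₂ + 676 * (2 + 312 / c₁)) * q := by positivity
  constructor
  · intro y hy
    refine sqNorm_inv_le hpd hK fun z => ?_
    have hz := dotProduct_self_nonneg z
    have hyy := dotProduct_self_nonneg y
    rw [Matrix.sub_mulVec, dotProduct_sub, dotProduct_sigma_mulVec, dotProduct_sigma_mulVec]
    have a1 : (z ⬝ᵥ (B *ᵥ y) + β * (z ⬝ᵥ y) - z ⬝ᵥ (A *ᵥ y)) ^ 2
        ≤ 2 * (β * (z ⬝ᵥ y)) ^ 2 + 2 * (z ⬝ᵥ (B *ᵥ y) - z ⬝ᵥ (A *ᵥ y)) ^ 2 := by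
      nlinarith [sq_nonneg (z ⬝ᵥ (B *ᵥ y) - z ⬝ᵥ (A *ᵥ y) - β * (z ⬝ᵥ y))]
    -- Bias of the regularizer: one factor `β` is bounded by `c₂ q`, the other is part of the form
    -- of `Σ̂`.
    have a2 : (β * (z ⬝ᵥ y)) ^ 2 ≤ c₂ * q * (z ⬝ᵥ (B *ᵥ z) + β * (z ⬝ᵥ z)) := by
      calc (β * (z ⬝ᵥ y)) ^ 2 = β ^ 2 * (z ⬝ᵥ y) ^ 2 := by ring
        _ ≤ β ^ 2 * ((z ⬝ᵥ z) * (y ⬝ᵥ y)) := by gcongr; exact dotProduct_sq_le z y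
        _ ≤ β ^ 2 * ((z ⬝ᵥ z) * 1) := by gcongr
        _ = β * (0 + β * (z ⬝ᵥ z)) := by ring
        _ ≤ c₂ * q * (z ⬝ᵥ (B *ᵥ z) + β * (z ⬝ᵥ z)) := by
            gcongr
            exact dotProduct_mulVec_self_nonneg hB z
    have a3 : (z ⬝ᵥ (B *ᵥ y) - z ⬝ᵥ (A *ᵥ y)) ^ 2
        ≤ 338 * q * ((2 + 312 / c₁) * (z ⬝ᵥ (B *ᵥ z) + β * (z ⬝ᵥ z))) := by
      have hz2 : 0 ≤ (2 + 312 / c₁) * (z ⬝ᵥ (B *ᵥ z) + β * (z ⬝ᵥ z)) :=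
        mul_nonneg (by positivity) (hS z)
      calc _ ≤ _ := h1 z y
        _ ≤ 338 * q * (y ⬝ᵥ y) * ((2 + 312 / c₁) * (z ⬝ᵥ (B *ᵥ z) + β * (z ⬝ᵥ z))) := by
            gcongr
            exact hκ z
        _ ≤ 338 * q * 1 * ((2 + 312 / c₁) * (z ⬝ᵥ (B *ᵥ z) + β * (z ⬝ᵥ z))) := by gcongr
        _ = _ := by ring
    linarith
  · refine sqNorm_inv_le hpd hK fun z => ?_
    rw [dotProduct_sigma_mulVec]
    have a3 : (z ⬝ᵥ u) ^ 2 ≤ 338 * q * ((2 + 312 / c₁) * (z ⬝ᵥ (B *ᵥ z) + β * (z ⬝ᵥ z))) :=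
      (h2 z).trans (by gcongr; exact hκ z)
    have a4 : 0 ≤ 2 * c₂ * q * (z ⬝ᵥ (B *ᵥ z) + β * (z ⬝ᵥ z)) := mul_nonneg (by positivity) (hS z)
    have a5 : 0 ≤ 338 * q * ((2 + 312 / c₁) * (z ⬝ᵥ (B *ᵥ z) + β * (z ⬝ᵥ z))) :=
      mul_nonneg (by positivity) (mul_nonneg (by positivity) (hS z))
    linarith

lemma isHermitian_empLifted {X : Type*} [MeasurableSpace X] (c : ℕ → X) (t : ℕ)
    (p : Kernel X (Action d)) : (empLifted c t p).IsHermitian := by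
  simp only [Matrix.IsHermitian, empLifted, conjTranspose_eq_transpose_of_trivial, transpose_smul,
    transpose_sum, liftedCov_transpose]

lemma isHermitian_popLifted {X : Type*} [MeasurableSpace X] (D : Measure X)
    (p : Kernel X (Action d)) : (popLifted D p).IsHermitian := by
  ext i j
  simp only [popLifted, conjTranspose_apply, of_apply, star_trivial]
  exact integral_congr_ae (.of_forall fun x => congrFun₂ (liftedCov_transpose (p x)) i j)

lemma isHermitian_mul_mul_transpose {m n : Type*} [Fintype n] (R : Matrix m n ℝ)
    {M : Matrix n n ℝ} (hM : M.IsHermitian) : (R * M * Rᵀ).IsHermitian := by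
  simpa using Matrix.isHermitian_mul_mul_conjTranspose R hM

lemma posSemidef_empLifted {X : Type*} [MeasurableSpace X] {p : Kernel X (Action d)}
    [IsMarkovKernel p] (hp : ∀ x, ∀ᵐ a ∂p x, ‖a‖ ≤ 1) (c : ℕ → X) {t : ℕ} (ht : 2 ≤ t) :
    (empLifted c t p).PosSemidef := by
  have hn : 0 ≤ ((t : ℝ) - 1)⁻¹ := by
    have : (2 : ℝ) ≤ t := by exact_mod_cast ht
    exact inv_nonneg.mpr (by linarith)
  exact (Matrix.posSemidef_sum _ fun τ _ => posSemidef_liftedCov (hp (c τ))).smul hn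

/-- All the claimed bounds for one policy, from concentration of its lifted covariance matrix. -/
lemma bounds_of_lifted {X : Type*} [MeasurableSpace X] {D : Measure X} [IsProbabilityMeasure D]
    {p : Kernel X (Action d)} [IsMarkovKernel p] (hp : ∀ x, ∀ᵐ a ∂p x, ‖a‖ ≤ 1) {c : ℕ → X}
    {t : ℕ} (ht : 2 ≤ t) {c₁ c₂ β q : ℝ} (hc₁ : 0 < c₁) (hβ : 0 < β) (hq : 0 < q)
    (hβ₁ : q ≤ 3 * β / c₁) (hβ₂ : β ≤ c₂ * q)
    (h : ∀ w v : Fin d ⊕ Unit → ℝ, w ⬝ᵥ w ≤ 1 → v ⬝ᵥ v ≤ 1 →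
      (1 / 2) * w ⬝ᵥ (popLifted D p *ᵥ w) ≤ w ⬝ᵥ (empLifted c t p *ᵥ w) + 25 * q ∧
      (w ⬝ᵥ (empLifted c t p *ᵥ v) - w ⬝ᵥ (popLifted D p *ᵥ v)) ^ 2
        ≤ 169 * q * (w ⬝ᵥ (popLifted D p *ᵥ w) + 2 * q)) :
    (∀ y : Fin d → ℝ, y ⬝ᵥ y ≤ 1 →
      sqNorm (sigmaHat β c t p)⁻¹ ((sigmaHat β c t p - popCov D c t p) *ᵥ y)
        ≤ (2 * c₂ + 676 * (2 + 312 / c₁)) * q) ∧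
    sqNorm (sigmaHat β c t p)⁻¹ (popMean D p - empMean c t p)
      ≤ (2 * c₂ + 676 * (2 + 312 / c₁)) * q ∧
    (empCov c t p + (50 * q) • (1 : Matrix (Fin d) (Fin d) ℝ)
      - (1 / 2 : ℝ) • popCov D c t p).PosSemidef ∧
    (empLifted c t p + (50 * q) • (1 : Matrix (Fin d ⊕ Unit) (Fin d ⊕ Unit) ℝ)
      - (1 / 2 : ℝ) • popLifted D p).PosSemidef := by
  have k1 := half_le_of_unit fun w hw => (h w 0 hw (by simp)).1
  have k2 := sq_sub_le_of_unit fun w v hw hv => (h w v hw hv).2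
  set R := centering (empMean c t p) with hR
  have hBeq : empCov c t p = R * empLifted c t p * Rᵀ := empCov_eq hp
  have hAeq : popCov D c t p = R * popLifted D p * Rᵀ := popCov_eq hp
  have hw : ∀ z, (Rᵀ *ᵥ z) ⬝ᵥ (Rᵀ *ᵥ z) ≤ 2 * (z ⬝ᵥ z) :=
    centering_transpose_mulVec_dotProduct_self_le hp ht
  have bB : ∀ z y, z ⬝ᵥ (empCov c t p *ᵥ y) = (Rᵀ *ᵥ z) ⬝ᵥ (empLifted c t p *ᵥ (Rᵀ *ᵥ y)) :=
    fun z y => by rw [hBeq, dotProduct_mul_mul_transpose_mulVec]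
  have bA : ∀ z y, z ⬝ᵥ (popCov D c t p *ᵥ y) = (Rᵀ *ᵥ z) ⬝ᵥ (popLifted D p *ᵥ (Rᵀ *ᵥ y)) :=
    fun z y => by rw [hAeq, dotProduct_mul_mul_transpose_mulVec]
  have hBpsd : (empCov c t p).PosSemidef := by
    rw [hBeq]
    simpa using (posSemidef_empLifted hp c ht).mul_mul_conjTranspose_same R
  -- `50 = 2 * 25`, from the norm doubling in `hw`.
  have m1 : ∀ z, (1 / 2) * z ⬝ᵥ (popCov D c t p *ᵥ z)
      ≤ z ⬝ᵥ (empCov c t p *ᵥ z) + 50 * q * (z ⬝ᵥ z) := fun z => by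
    rw [bA, bB]
    have := k1 (Rᵀ *ᵥ z)
    nlinarith [hw z]
  -- Replaces the population variance by the empirical one through `m1`; `104 = 2 * 50 + 2 * 2`.
  have m2 : ∀ z, (Rᵀ *ᵥ z) ⬝ᵥ (popLifted D p *ᵥ (Rᵀ *ᵥ z))
      + 2 * q * ((Rᵀ *ᵥ z) ⬝ᵥ (Rᵀ *ᵥ z))
      ≤ 2 * z ⬝ᵥ (empCov c t p *ᵥ z) + 104 * q * (z ⬝ᵥ z) := fun z => by
    have h1 := m1 z
    rw [bA] at h1
    nlinarith [hw z]
  have m0 : ∀ z, 0 ≤ 2 * z ⬝ᵥ (empCov c t p *ᵥ z) + 104 * q * (z ⬝ᵥ z) := fun z =>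
    add_nonneg (mul_nonneg zero_le_two (dotProduct_mulVec_self_nonneg hBpsd z))
      (mul_nonneg (by positivity) (dotProduct_self_nonneg z))
  have main := sqNorm_bounds (A := popCov D c t p) (u := popMean D p - empMean c t p) hc₁ hβ hq
    hβ₁ hβ₂ hBpsd (fun z y => by
      rw [bB z y, bA z y]
      have hy := dotProduct_self_nonneg y
      have hRy := dotProduct_self_nonneg (Rᵀ *ᵥ y)
      calc _ ≤ _ := k2 (Rᵀ *ᵥ z) (Rᵀ *ᵥ y)
        _ ≤ 169 * q * ((Rᵀ *ᵥ y) ⬝ᵥ (Rᵀ *ᵥ y))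
            * (2 * z ⬝ᵥ (empCov c t p *ᵥ z) + 104 * q * (z ⬝ᵥ z)) := by
            exact mul_le_mul_of_nonneg_left (m2 z) (by positivity)
        _ ≤ 169 * q * (2 * (y ⬝ᵥ y))
            * (2 * z ⬝ᵥ (empCov c t p *ᵥ z) + 104 * q * (z ⬝ᵥ z)) := by
            have := m0 z
            gcongr
            exact hw y
        _ = _ := by ring) (fun z => by
      have e := centering_dotProduct_sub_single (D := D) (c := c) (p := p) ht z
      have hneg : (z ⬝ᵥ (popMean D p - empMean c t p)) ^ 2
          = (z ⬝ᵥ (empMean c t p - popMean D p)) ^ 2 := by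
        rw [← neg_sub (empMean c t p), dotProduct_neg, neg_sq]
      rw [hneg, ← e]
      have := k2 (Rᵀ *ᵥ z) (Pi.single (Sum.inr ()) 1)
      simp only [dotProduct_single, mul_one, Pi.single_eq_same] at this
      calc _ ≤ _ := this
        _ ≤ 338 * q * (2 * z ⬝ᵥ (empCov c t p *ᵥ z) + 104 * q * (z ⬝ᵥ z)) := by
          have h0 := m0 z
          have h1 := mul_le_mul_of_nonneg_left (m2 z) (by positivity : 0 ≤ 169 * q)
          have h3 := mul_nonneg (by positivity : 0 ≤ 169 * q) h0
          linarith)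
  refine ⟨main.1, main.2, posSemidef_add_smul_sub_half ?_ hBpsd.1 m1,
    posSemidef_add_smul_sub_half (isHermitian_popLifted D p) (isHermitian_empLifted c t p)
      fun w => ?_⟩
  · rw [hAeq]
    exact isHermitian_mul_mul_transpose R (isHermitian_popLifted D p)
  · have := k1 w
    nlinarith [dotProduct_self_nonneg w]

end Bounds

end LinCB

/-! ### Assembly and constants. -/

theorem mainTheorem2 (c₁ c₂ : ℝ) (hc₁ : 0 < c₁) (hc₂ : c₁ ≤ c₂) :
    ∃ C : ℝ, 0 < C ∧
      ∀ (d T : ℕ) (δ : ℝ), 1 ≤ d → 0 < δ → δ < 1 →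
      -- the regularization parameters `β_t = Θ((d+1)³ log(T/δ) / (t-1))`
      ∀ β : ℕ → ℝ,
        (∀ t ∈ Finset.Icc 2 T,
          c₁ * (((d : ℝ) + 1) ^ 3 * Real.log (T / δ) / ((t : ℝ) - 1)) ≤ β t ∧
          β t ≤ c₂ * (((d : ℝ) + 1) ^ 3 * Real.log (T / δ) / ((t : ℝ) - 1))) →
      -- contexts, their action sets in the unit ball, and the context distribution `D`
      ∀ (X : Type*) [MeasurableSpace X] (act : X → Set (LinCB.Action d)),
        (∀ x, ∀ a ∈ act x, ‖a‖ ≤ 1) →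
      ∀ (D : MeasureTheory.Measure X) [MeasureTheory.IsProbabilityMeasure D],
      -- i.i.d. contexts `ctx 1, …, ctx T` with law `D`
      ∀ (Ω : Type*) [MeasurableSpace Ω] (μ : MeasureTheory.Measure Ω)
        [MeasureTheory.IsProbabilityMeasure μ] (ctx : ℕ → Ω → X),
        (∀ τ ∈ Finset.Icc 1 T, Measurable (ctx τ) ∧ μ.map (ctx τ) = D) →
        ProbabilityTheory.iIndepFun (fun τ : Finset.Icc 1 T => ctx τ) μ →
      ∃ E : Set Ω, MeasurableSet E ∧ ENNReal.ofReal (1 - δ) ≤ μ E ∧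
        ∀ ω ∈ E, ∀ t ∈ Finset.Icc 2 T, ∀ p ∈ LinCB.policyClass act T,
          (∀ y : LinCB.Action d, ‖y‖ ≤ 1 →
            LinCB.sqNorm (LinCB.sigmaHat (β t) (fun τ => ctx τ ω) t p)⁻¹
              ((LinCB.sigmaHat (β t) (fun τ => ctx τ ω) t p
                - LinCB.popCov D (fun τ => ctx τ ω) t p) *ᵥ (fun i => y i))
              ≤ C * ((d : ℝ) ^ 3 * Real.log (d * T / δ) / t)) ∧
          LinCB.sqNorm (LinCB.sigmaHat (β t) (fun τ => ctx τ ω) t p)⁻¹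
              (LinCB.popMean D p - LinCB.empMean (fun τ => ctx τ ω) t p)
              ≤ C * ((d : ℝ) ^ 3 * Real.log (d * T / δ) / t) ∧
          (LinCB.empCov (fun τ => ctx τ ω) t p
            + (50 * ((d : ℝ) + 1) ^ 3 * Real.log (3 * T / δ) / ((t : ℝ) - 1)) •
                (1 : Matrix (Fin d) (Fin d) ℝ)
            - (1 / 2 : ℝ) • LinCB.popCov D (fun τ => ctx τ ω) t p).PosSemidef ∧
          (LinCB.empLifted (fun τ => ctx τ ω) t p
            + (50 * ((d : ℝ) + 1) ^ 3 * Real.log (3 * T / δ) / ((t : ℝ) - 1)) •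
                (1 : Matrix (Fin d ⊕ Unit) (Fin d ⊕ Unit) ℝ)
            - (1 / 2 : ℝ) • LinCB.popLifted D p).PosSemidef := by
  have hc₂' : 0 < c₂ := hc₁.trans_le hc₂
  -- `48 = 8 * 3 * 2`, from `(d+1)³ ≤ 8d³`, `log(3T/δ) ≤ 3 log(dT/δ)` and `1/(t-1) ≤ 2/t`.
  refine ⟨48 * (2 * c₂ + 676 * (2 + 312 / c₁)), by positivity, ?_⟩
  intro d T δ hd hδ hδ1 β hβ X _ act hact D _ Ω _ μ _ ctx hctx hind
  by_cases hT : 2 ≤ T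
  swap
  · refine ⟨Set.univ, MeasurableSet.univ, ?_, fun ω _ t ht => ?_⟩
    · rw [measure_univ, ← ENNReal.ofReal_one]
      exact ENNReal.ofReal_le_ofReal (by linarith)
    · rw [Finset.mem_Icc] at ht
      omega
  let P := {p : Kernel X (LinCB.Action d) // p ∈ LinCB.policyClass act T}
  have hZ : ∀ p : P, ∃ Z ∈ LinCB.parameterBox d T,
      ∀ x, LinCB.IsArgmin (act x) Z (LinCB.liftedCov (p.1 x)) := fun p => p.2.2
  -- One parameter per policy, the same for every context, so the Lipschitz bound is uniform in the
  -- context.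
  choose θ hθ hmin using hZ
  have hmk : ∀ p : P, IsMarkovKernel p.1 := fun p => ⟨fun x => (p.2.1 x).1⟩
  have hae : ∀ (p : P) x, ∀ᵐ a ∂p.1 x, ‖a‖ ≤ 1 := fun p x => (p.2.1 x).ae_norm_le_one (hact x)
  have hcard : Fintype.card (Fin d ⊕ Unit) = d + 1 := by simp
  obtain ⟨E, hEm, hEμ, hE⟩ := LinCB.exists_uniform_event (n := Fin d ⊕ Unit)
    (by rw [hcard]; omega) hT hδ hδ1 hctx hind (fun (p : P) x => LinCB.liftedCov (p.1 x)) θ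
    (fun p => LinCB.measurable_liftedCov p.1) (fun p x => LinCB.posSemidef_liftedCov (hae p x))
    (fun p x => LinCB.dotProduct_liftedCov_mulVec_self_le (hae p x)) (fun p => (hθ p).2)
    (fun p p' x => (hmin p x).sum_sq_sub_le (hact x) (hmin p' x))
  refine ⟨E, hEm, hEμ, fun ω hω t ht p hp => ?_⟩
  have hmp := hmk ⟨p, hp⟩
  obtain ⟨ht2, htT⟩ := Finset.mem_Icc.mp ht
  obtain ⟨hβ1, hβ2⟩ := hβ t ht
  have htr : (2 : ℝ) ≤ t := by exact_mod_cast ht2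
  have hTr : (2 : ℝ) ≤ T := by exact_mod_cast hT
  have hdr : (1 : ℝ) ≤ d := by exact_mod_cast hd
  have hn : 0 < (t : ℝ) - 1 := by linarith
  have hTδ : (2 : ℝ) < T / δ := by rw [lt_div_iff₀ hδ]; nlinarith
  have hlog : 0 < Real.log (T / δ) := Real.log_pos (by linarith)
  have hlog3 : Real.log (3 * T / δ) ≤ 3 * Real.log (T / δ) := by
    have : 3 * Real.log (T / δ) = Real.log ((T / δ) ^ 3) := by rw [Real.log_pow]; norm_num
    rw [this, mul_div_assoc]
    -- `3x ≤ x³` for `x = T/δ > 2`.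
    exact Real.log_le_log (by positivity) (by nlinarith [sq_nonneg ((T : ℝ) / δ)])
  have hlog3' : Real.log (T / δ) ≤ Real.log (3 * T / δ) := by
    rw [mul_div_assoc]
    exact Real.log_le_log (by positivity) (by linarith)
  have hlogd : Real.log (T / δ) ≤ Real.log (d * T / δ) := by
    rw [mul_div_assoc]
    exact Real.log_le_log (by positivity) (by nlinarith)
  set q := ((d : ℝ) + 1) ^ 3 * Real.log (3 * T / δ) / ((t : ℝ) - 1) with hq
  have hq0 : 0 < q := by
    have : 0 < Real.log (3 * T / δ) := by linarith
    positivity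
  have hβ0 : 0 < β t := lt_of_lt_of_le (by positivity) hβ1
  have hqβ : q ≤ 3 * β t / c₁ := by
    rw [le_div_iff₀ hc₁]
    have : q ≤ 3 * (((d : ℝ) + 1) ^ 3 * Real.log (T / δ) / ((t : ℝ) - 1)) := by
      rw [hq, ← mul_div_assoc, mul_left_comm]
      gcongr
    nlinarith
  have hβq : β t ≤ c₂ * q := hβ2.trans (by
    rw [hq]
    gcongr)
  have hqC : q ≤ 48 * ((d : ℝ) ^ 3 * Real.log (d * T / δ) / t) := by
    have h1 : ((d : ℝ) + 1) ^ 3 ≤ 8 * (d : ℝ) ^ 3 := by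
      calc ((d : ℝ) + 1) ^ 3 ≤ (2 * (d : ℝ)) ^ 3 := by gcongr; linarith
        _ = _ := by ring
    have h2 : Real.log (3 * T / δ) ≤ 3 * Real.log (d * T / δ) := by linarith
    have h3 : 0 ≤ Real.log (d * T / δ) := by linarith
    calc q ≤ (8 * (d : ℝ) ^ 3) * (3 * Real.log (d * T / δ)) / ((t : ℝ) - 1) := by
          rw [hq]; gcongr; linarith
      _ ≤ (8 * (d : ℝ) ^ 3) * (3 * Real.log (d * T / δ)) / (t / 2) := by
          gcongr; linarith
      _ = _ := by field_simp; ring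
  have hfin : (2 * c₂ + 676 * (2 + 312 / c₁)) * q ≤ 48 * (2 * c₂ + 676 * (2 + 312 / c₁))
      * ((d : ℝ) ^ 3 * Real.log (d * T / δ) / t) := by
    have : 0 ≤ 2 * c₂ + 676 * (2 + 312 / c₁) := by positivity
    calc _ ≤ _ := mul_le_mul_of_nonneg_left hqC this
      _ = _ := by ring
  have hc50 : 50 * ((d : ℝ) + 1) ^ 3 * Real.log (3 * T / δ) / ((t : ℝ) - 1) = 50 * q := by
    rw [hq]; ring
  have hqcard : q = (Fintype.card (Fin d ⊕ Unit) : ℝ) ^ 3 * Real.log (3 * T / δ)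
      / ((t : ℝ) - 1) := by
    rw [hcard]; push_cast; rfl
  obtain ⟨b1, b2, b3, b4⟩ := LinCB.bounds_of_lifted (hae ⟨p, hp⟩) ht2 hc₁ hβ0 hq0 hqβ hβq
    (fun w v hw hv => hE ω hω t ht q hqcard ⟨p, hp⟩ w v hw hv)
  rw [hc50]
  refine ⟨fun y hy => (b1 (fun i => y i) ?_).trans hfin, b2.trans hfin, b3, b4⟩
  have : (fun i => y i) ⬝ᵥ (fun i => y i) = ‖y‖ ^ 2 := by
    simp [dotProduct, EuclideanSpace.norm_sq_eq, ← sq]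
  rw [this]
  exact pow_le_one₀ (norm_nonneg y) hy
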